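/- **Setting.** For an activation $\sigma:\mathbb R^d\times\mathbb R^d\to\mathbb R$ and a target network $f(x)=\sum_{j=1}^k b_j\,\sigma(x,w_j)$, learn with a network of the same size under the squared loss with standard Gaussian input (the sign of $\boldsymbol a$ is reversed, so the learned network is $\sum_i(-a_i)\sigma(x,\theta_i)$): $$L(\boldsymbol a,\boldsymbol\theta)=\mathbb E_{X\sim\mathcal N(0,I_d)}\Big[\Big(\sum_{i=1}^k a_i\sigma(X,\theta_i)+\sum_{j=1}^k b_j\sigma(X,w_j)\Big)^2\Big].$$ Activations are measurable, square integrable in $x$ under $\mathcal N(0,I_d)$, and their potential $\Phi(\theta,w)=\mathbb E[\sigma(X,\theta)\sigma(X,w)]$ depends only on $\|\theta-w\|$, with $\Phi(\theta,\theta)=1$. **SecondGD** on an objective $g$ from a point $x$ with parameters $T,\alpha,\eta,\gamma$: repeat at most $T$ times: let $y=x-\alpha\nabla g(x)$ if $\|\nabla g(x)\|\ge\eta$; otherwise let $y=x-\alpha\,|\lambda_{\min}|\,s\,v$, where $v$ is a unit eigenvector of $\nabla^2g(x)$ for its smallest eigenvalue $\lambda_{\min}$ and $s=\pm1$ is the sign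 of $\langle\nabla g(x),v\rangle$ (with $s=1$ if it is $0$). If $g(y)\ge g(x)-\min(\alpha\eta^2/2,\alpha^2\gamma^3/2)$, stop and return $x$; otherwise replace $x$ by $y$. **Node-wise descent**: start with $\boldsymbol a=0$; for $i=1,\dots,k$ initialise $(a_i,\theta_i)$ and replace it by the output of SecondGD on $L_i$, the loss $L$ as a function of $(a_i,\theta_i)$ with all other parameters fixed at their current values. The initialisation of node $i$ is *admissible with margin $\delta$* if $\sqrt{L_i(a_i,\theta_i)}\le\sqrt{L_i(0,0)}-\delta$. **Theorem.** There are activations $\sigma_{d,\varepsilon}$ on $\mathbb R^d$, for $d\equiv 3\pmod 4$ and $\varepsilon\in(0,1)$, with the following property. For all $K,q\in\mathbb N$ and $0<c_1\le c_2$ there are constants $c,C>0$ and $d_0$ such that for all $d\ge d_0$ with $d\equiv3\pmod 4$, all $\varepsilon\in(0,1)$, all $1\le k\le d^K$ and all $s$ with $c_1 d\log d\le s\le c_2 d\log d$ there are $\alpha,\eta,\gamma>0$, $\delta\ge(d/\varepsilon)^{-Cd}$ and $T\in\mathbb N$ with $kT\le (d/\varepsilon)^{Cd}$ such that, if $w_1,\dots,w_k\sim\mathcal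 N(0,sI_d)$ and $b_1,\dots,b_k$ uniform on $[-1,1]$ are drawn independently, then with probability at least $1-d^{-q}$ the following holds for $\sigma=\sigma_{d,\varepsilon}$, whatever choice of unit eigenvectors SecondGD uses. 1. (Initialisation is possible.) At every stage $i$ of node-wise descent, if the earlier initialisations were admissible with margin $\delta$, then a point $\theta_i$ drawn uniformly from the ball of radius $C d\log d$ about the origin, together with a minimiser $a_i$ of $a\mapsto L_i(a,\theta_i)$, is admissible with margin $\delta$ with probability at least $(\log d)^{-Cd}$. 2. (Convergence.) For every choice of initialisations admissible with margin $\delta$, node-wise descent with parameters $T,\alpha,\eta,\gamma$ (hence with at most $(d/\varepsilon)^{Cd}$ iterations in total) ends at a point $(\boldsymbol a,\boldsymbol\theta)$ within Euclidean distance $(d/\varepsilon)^{-cd}$ of a global minimum of $L$ of the form $\big((-b_{\pi(i)})_i,(w_{\pi(i)})_i\big)$ for some permutation $\pi$ of $\{1,\dots,k\}$. -/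

import Mathlib

open MeasureTheory ProbabilityTheory Set

noncomputable section

namespace NodeWise

/-- The space `ℝ^d` with its Euclidean norm. -/
abbrev E (d : ℕ) : Type := EuclideanSpace ℝ (Fin d)

/-- The parameters `(a, θ)` of a single hidden node, with the Euclidean norm of `ℝ^(1+d)`. -/
abbrev Node (d : ℕ) : Type := WithLp 2 (ℝ × E d)

/-- The parameters `(a₁, …, a_k, θ₁, …, θ_k)` of a network with `k` hidden nodes. -/
abbrev Params (d k : ℕ) : Type := (Fin k → ℝ) × (Fin k → E d)

/-! ### Activations, potentials and the squared loss -/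

/-- The potential `Φ(θ, w) = 𝔼[σ(X, θ) σ(X, w)]` of an activation, for standard Gaussian `X`. -/
def potential {d : ℕ} (σ : E d → E d → ℝ) (θ w : E d) : ℝ :=
  ∫ x, σ x θ * σ x w ∂(stdGaussian (E d))

/-- Activations: measurable functions `σ(x, w)`, square integrable in the Gaussian input `x`,
whose potential is radial and normalised by `Φ(θ, θ) = 1`. -/
structure IsActivation {d : ℕ} (σ : E d → E d → ℝ) : Prop where
  measurable : Measurable (Function.uncurry σ)
  memLp : ∀ w, MemLp (fun x => σ x w) 2 (stdGaussian (E d))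
  radial : ∃ φ : ℝ → ℝ, φ 0 = 1 ∧ ∀ θ w, potential σ θ w = φ ‖θ - w‖

/-- The squared loss `𝔼[(∑ᵢ aᵢ σ(X, θᵢ) + ∑ⱼ bⱼ σ(X, wⱼ))²]`, for standard Gaussian `X`. The sign
of `a` is reversed: the learned network is `∑ᵢ (-aᵢ) σ(x, θᵢ)`, the target is `∑ⱼ bⱼ σ(x, wⱼ)`. -/
def loss {d k : ℕ} (σ : E d → E d → ℝ) (w : Fin k → E d) (b : Fin k → ℝ) (p : Params d k) : ℝ :=
  ∫ x, (∑ i, p.1 i * σ x (p.2 i) + ∑ j, b j * σ x (w j)) ^ 2 ∂(stdGaussian (E d))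

/-- Replace the parameters of node `i`. -/
def setNode {d k : ℕ} (p : Params d k) (i : Fin k) (x : Node d) : Params d k :=
  (Function.update p.1 i x.fst, Function.update p.2 i x.snd)

/-- The restriction `L_{aᵢ, θᵢ}` of an objective `L` to the parameters of node `i`, all the other
parameters being fixed at their values in `p`. -/
def nodeObjective {d k : ℕ} (L : Params d k → ℝ) (p : Params d k) (i : Fin k) (x : Node d) : ℝ :=
  L (setNode p i x)

/-! ### Second-order gradient descent -/

section Descent

variable {H : Type*} [NormedAddCommGroup H] [InnerProductSpace ℝ H] [CompleteSpace H]

/-- The Hessian of `f` at `x`, as an operator. -/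
def hessian (f : H → ℝ) (x : H) : H →L[ℝ] H := fderiv ℝ (gradient f) x

/-- The smallest eigenvalue of an operator. -/
def lamMin (A : H →L[ℝ] H) : ℝ := sInf {μ : ℝ | Module.End.HasEigenvalue (A : H →ₗ[ℝ] H) μ}

/-- `v` picks, for every symmetric operator, a unit eigenvector for the smallest eigenvalue. -/
def IsMinEigenvectorChoice (v : (H →L[ℝ] H) → H) : Prop :=
  ∀ A : H →L[ℝ] H, (A : H →ₗ[ℝ] H).IsSymmetric → ‖v A‖ = 1 ∧ A (v A) = lamMin A • v A

/-- One step of Hessian descent, of length `α |λ_min|` along a unit eigenvector for the smallest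
eigenvalue of the Hessian, in the direction in which `f` does not increase to first order. -/
def hdStep (f : H → ℝ) (v : (H →L[ℝ] H) → H) (α : ℝ) (x : H) : H :=
  let u := v (hessian f x)
  let s : ℝ := if 0 ≤ inner ℝ (gradient f x) u then 1 else -1
  x + (-(α * |lamMin (hessian f x)| * s)) • u

/-- Hessian descent, `T` steps. -/
def hd (f : H → ℝ) (v : (H →L[ℝ] H) → H) (x₀ : H) (T : ℕ) (α : ℝ) : H :=
  (hdStep f v α)^[T] x₀

/-- `SecondGD`: at most `T` iterations, each a gradient step if the gradient is at least `η` in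
norm and a Hessian descent step otherwise; stop at the current point as soon as the step fails to
decrease the objective by more than `min (α η² / 2) (α² γ³ / 2)`. -/
def secondGD (f : H → ℝ) (v : (H →L[ℝ] H) → H) : H → ℕ → ℝ → ℝ → ℝ → H
  | x, 0, _, _, _ => x
  | x, T + 1, α, η, γ =>
    open Classical in
    let y := if η ≤ ‖gradient f x‖ then x - α • gradient f x else hd f v x 1 α
    if f x - min (α * η ^ 2 / 2) (α ^ 2 * γ ^ 3 / 2) ≤ f y then x
    else secondGD f v y T α η γ

end Descent

/-! ### Node-wise descent -/

/-- The parameters after the first `n` nodes have been processed by node-wise descent: starting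
from the zero network, for `i = 1, …, k`, node `i` is initialised at `init i` and `SecondGD` is run
on the objective restricted to the parameters of node `i`. -/
def nodewise {d k : ℕ} (L : Params d k → ℝ) (v : (Node d →L[ℝ] Node d) → Node d)
    (T : ℕ) (α η γ : ℝ) (init : Fin k → Node d) : ℕ → Params d k
  | 0 => 0
  | n + 1 =>
    let p := nodewise L v T α η γ init n
    if h : n < k then
      setNode p ⟨n, h⟩ (secondGD (nodeObjective L p ⟨n, h⟩) v (init ⟨n, h⟩) T α η γ)
    else p

/-- `x` is an admissible initialisation of a node with objective `f` and margin `δ`: it lowers the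
square root of the loss by at least `δ`, compared with leaving the node out. -/
def GoodInit {d : ℕ} (f : Node d → ℝ) (δ : ℝ) (x : Node d) : Prop :=
  √(f x) ≤ √(f 0) - δ

/-- `θ` is a successful sample for the initialisation of a node with objective `f`: together with
an optimal output weight for `θ` it is an admissible initialisation. -/
def GoodSample {d : ℕ} (f : Node d → ℝ) (δ : ℝ) (θ : E d) : Prop :=
  ∃ a : ℝ, (∀ a' : ℝ, f (WithLp.toLp 2 (a, θ)) ≤ f (WithLp.toLp 2 (a', θ))) ∧
    GoodInit f δ (WithLp.toLp 2 (a, θ))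

/-- The initialisations `init` of the first `n` nodes are admissible when they are used. -/
def GoodInits {d k : ℕ} (L : Params d k → ℝ) (v : (Node d →L[ℝ] Node d) → Node d)
    (T : ℕ) (α η γ δ : ℝ) (init : Fin k → Node d) (n : ℕ) : Prop :=
  ∀ i : Fin k, (i : ℕ) < n →
    GoodInit (nodeObjective L (nodewise L v T α η γ init i) i) δ (init i)

/-- The uniform distribution on the closed ball of radius `R` about the origin. -/
def uniformBall (d : ℕ) (R : ℝ) : Measure (E d) :=
  ProbabilityTheory.cond volume (Metric.closedBall (0 : E d) R)

/-- Node-wise initialisation is possible: as long as the earlier nodes were initialised admissibly,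
a uniform sample from the ball of radius `R` is successful with probability at least `r`. -/
def InitSucceeds {d k : ℕ} (L : Params d k → ℝ) (v : (Node d →L[ℝ] Node d) → Node d)
    (T : ℕ) (α η γ δ R r : ℝ) : Prop :=
  ∀ (init : Fin k → Node d) (i : Fin k), GoodInits L v T α η γ δ init i →
    ENNReal.ofReal r ≤ uniformBall d R
      {θ | GoodSample (nodeObjective L (nodewise L v T α η γ init i) i) δ θ}

/-- The Euclidean distance on network parameters. -/
def paramDist {d k : ℕ} (p p' : Params d k) : ℝ :=
  √(∑ i, ((p.1 i - p'.1 i) ^ 2 + ‖p.2 i - p'.2 i‖ ^ 2))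

/-- The parameters, up to the sign convention for output weights, of the target network with its
hidden nodes permuted by `π`. -/
def permutedTarget {d k : ℕ} (w : Fin k → E d) (b : Fin k → ℝ) (π : Equiv.Perm (Fin k)) :
    Params d k :=
  (fun i => -b (π i), fun i => w (π i))

/-- Whatever admissible initialisations are used, the final parameters are within `ρ` of a global
minimum of the squared loss that is the target network up to a permutation of its nodes. -/
def Recovers {d k : ℕ} (σ : E d → E d → ℝ) (w : Fin k → E d) (b : Fin k → ℝ)
    (v : (Node d →L[ℝ] Node d) → Node d) (T : ℕ) (α η γ δ ρ : ℝ) : Prop :=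
  ∀ init : Fin k → Node d, GoodInits (loss σ w b) v T α η γ δ init k →
    ∃ π : Equiv.Perm (Fin k),
      IsMinOn (loss σ w b) univ (permutedTarget w b π) ∧
      paramDist (nodewise (loss σ w b) v T α η γ init k) (permutedTarget w b π) ≤ ρ

/-! ### The random target network -/

/-- The law of the target network `(w, b)`: independent `wᵢ ∼ N(0, s I)` and `bᵢ` uniform on
`[-1, 1]`. -/
def targetLaw (d k : ℕ) (s : ℝ) : Measure ((Fin k → E d) × (Fin k → ℝ)) :=
  (Measure.pi fun _ : Fin k => multivariateGaussian (0 : E d) (s • (1 : Matrix (Fin d) (Fin d) ℝ))).prod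
    (Measure.pi fun _ : Fin k => ProbabilityTheory.cond (volume : Measure ℝ) (Icc (-1) 1))

end NodeWise

end

namespace NodeWise

/-! ### A smooth bump and its autocorrelation -/

/-! The activation is built so that its potential has compact support and no spurious critical
points. Dividing a translated bump by the square root of the Gaussian density turns the Gaussian
expectation into a Lebesgue integral, so the potential is a normalised autocorrelation φ of the
bump, rescaled to vanish outside radius d; one activation serves all ε. The bump is strongly
log-concave on its support, whence ⟨∇φ(u), u⟩ ≤ -(2/d²)‖u‖²φ(u) (`bumpCorrDeriv_apply_self_le`,
`exists_isLocalKernel`): where φ is positive, its only critical point is the centre.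

Targets with variance s of order d log d per coordinate lie at distances of order d√(log d), so with
high probability they are 3d-separated and their potentials do not overlap (`targetLaw_not_good_le`,
`failure_probability_le`). With the other nodes fixed, the loss is A + 2aF(θ) + a² (`loss_setNode`),
where F superposes the potentials of learned and target nodes. Near a target already learned F
almost cancels; near any other target it equals b_j φ(θ - w_j). The loss is at least A - F² and
never increases under `secondGD`, so an admissible start forces |F| ≥ δ at the point returned. With
enough iterations that point has small gradient (`secondGD_spec`, `nodeQuad_gradient_step`), and the
drift inequality puts it next to an unlearned target, with a close to -b_j (`Matched.exists_close`).
Each stage matches one new target, so after k stages the matching is a permutation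
(`recovers_of_isGoodParams`). Hessian steps are harmless, being accepted only if they lower the
loss.

For the initialisation, every point within d/2 of an unlearned target is successful
(`Matched.goodSample`), and such a ball fills a fraction (2C log d)^(-d) of the sampling ball. The
kernel constants are exponential in d at worst, so all parameters can be powers of Y = (d/ε)^d
(`exists_isGoodParams`). -/

lemma expNegInvGlue_le_one (y : ℝ) : expNegInvGlue y ≤ 1 := by
  unfold expNegInvGlue
  split_ifs with h
  · exact zero_le_one
  · exact Real.exp_le_one_iff.2 (neg_nonpos.2 (inv_nonneg.2 (not_le.1 h).le))

lemma differentiable_expNegInvGlue : Differentiable ℝ expNegInvGlue :=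
  (expNegInvGlue.contDiff (n := 1)).differentiable (by norm_num)

lemma deriv_expNegInvGlue_of_neg {y : ℝ} (hy : y < 0) : deriv expNegInvGlue y = 0 := by
  have : expNegInvGlue =ᶠ[nhds y] fun _ => (0 : ℝ) := by
    filter_upwards [Iio_mem_nhds hy] with z hz
    exact expNegInvGlue.zero_of_nonpos (le_of_lt hz)
  rw [this.deriv_eq, deriv_const]

/-- Arguments up to 1 suffice, since the bump only evaluates at 1 - ‖x‖². Having 1 ≤ B lets B²
absorb B in later constants. -/
lemma exists_abs_deriv_expNegInvGlue_le :
    ∃ B : ℝ, 1 ≤ B ∧ ∀ y ≤ 1, |deriv expNegInvGlue y| ≤ B := by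
  have hc : Continuous (deriv expNegInvGlue) :=
    (expNegInvGlue.contDiff (n := 1)).continuous_deriv (by norm_num)
  obtain ⟨B, hB⟩ := (isCompact_Icc (a := (0 : ℝ)) (b := 1)).exists_bound_of_continuousOn
    hc.continuousOn
  refine ⟨max B 1, le_max_right _ _, fun y hy => ?_⟩
  rcases lt_or_ge y 0 with h | h
  · rw [deriv_expNegInvGlue_of_neg h]; simp
  · exact (hB y ⟨h, hy⟩).trans (le_max_left _ _)

/-- Strong log-concavity of `s ↦ expNegInvGlue (1 - s)` on `[0, ∞)`, in symmetric form. -/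
lemma expNegInvGlue_mul_le {A A' B B' : ℝ} (hA : A ≤ A') (hB : |B| ≤ |B'|) (hAB : |B| ≤ A) :
    expNegInvGlue (1 - (A' + B')) * expNegInvGlue (1 - (A' - B')) ≤
      Real.exp (-(A' - A)) *
        (expNegInvGlue (1 - (A + B)) * expNegInvGlue (1 - (A - B))) := by
  -- The product is even in b, so only |b| matters.
  have habs : ∀ a b : ℝ, expNegInvGlue (1 - (a + b)) * expNegInvGlue (1 - (a - b)) =
      expNegInvGlue (1 - a - |b|) * expNegInvGlue (1 - a + |b|) := by
    intro a b
    rcases abs_choice b with h | h <;> rw [h]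
    · congr 2 <;> ring
    · rw [mul_comm]; congr 2 <;> ring
  rw [habs, habs]
  set x := |B|
  set x' := |B'|
  have hx : 0 ≤ x := abs_nonneg B
  rcases le_or_gt (1 - A' - x') 0 with h0 | h0
  · rw [expNegInvGlue.zero_of_nonpos h0, zero_mul]
    exact mul_nonneg (Real.exp_pos _).le
      (mul_nonneg (expNegInvGlue.nonneg _) (expNegInvGlue.nonneg _))
  have h1 : 0 < 1 - A' + x' := by linarith
  have h2 : 0 < 1 - A' - x := by linarith
  have h3 : 0 < 1 - A' + x := by linarith
  have h4 : 0 < 1 - A - x := by linarith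
  have h5 : 0 < 1 - A + x := by linarith
  simp only [expNegInvGlue, not_le.2 h0, not_le.2 h1, not_le.2 h4, not_le.2 h5, if_false]
  rw [← Real.exp_add, ← Real.exp_add, ← Real.exp_add]
  refine Real.exp_le_exp.2 ?_
  -- On (0, 1] the slope of y⁻¹ is at most -1. The hypothesis |B| ≤ A keeps 1 - A ± |B| in this
  -- range.
  have inv_step : ∀ y y' : ℝ, 0 < y' → y' ≤ y → y ≤ 1 → y⁻¹ + (y - y') ≤ y'⁻¹ := by
    intro y y' hy' hyy hy
    have hy0 : 0 < y := hy'.trans_le hyy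
    have : y'⁻¹ - y⁻¹ = (y - y') * (y⁻¹ * y'⁻¹) := by field_simp
    have h1 : 1 ≤ y⁻¹ * y'⁻¹ :=
      one_le_mul_of_one_le_of_one_le ((one_le_inv₀ hy0).2 hy) ((one_le_inv₀ hy').2 (hyy.trans hy))
    nlinarith [mul_le_mul_of_nonneg_left h1 (sub_nonneg.2 hyy)]
  have e1 := inv_step (1 - A - x) (1 - A' - x) h2 (by linarith) (by linarith)
  have e2 := inv_step (1 - A + x) (1 - A' + x) h3 (by linarith) (by linarith)
  -- For fixed m > 0, (m - x)⁻¹ + (m + x)⁻¹ increases with x ∈ [0, m).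
  have e3 : (1 - A' - x)⁻¹ + (1 - A' + x)⁻¹ ≤ (1 - A' - x')⁻¹ + (1 - A' + x')⁻¹ := by
    have i1 : (1 - A' - x)⁻¹ + (1 - A' + x)⁻¹ =
        (2 * (1 - A')) / ((1 - A' - x) * (1 - A' + x)) := by field_simp; ring
    have i2 : (1 - A' - x')⁻¹ + (1 - A' + x')⁻¹ =
        (2 * (1 - A')) / ((1 - A' - x') * (1 - A' + x')) := by field_simp; ring
    rw [i1, i2]
    refine div_le_div_of_nonneg_left (by linarith) (mul_pos h0 h1) ?_
    nlinarith
  linarith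

variable {d : ℕ}

/-- A smooth bump supported in the closed unit ball. -/
noncomputable def bump (x : E d) : ℝ := expNegInvGlue (1 - ‖x‖ ^ 2)

lemma bump_nonneg (x : E d) : 0 ≤ bump x := expNegInvGlue.nonneg _

lemma bump_le_one (x : E d) : bump x ≤ 1 := expNegInvGlue_le_one _

lemma bump_neg (x : E d) : bump (-x) = bump x := by simp [bump]

lemma bump_sub_comm (x y : E d) : bump (x - y) = bump (y - x) := by
  rw [← bump_neg, neg_sub]

lemma bump_eq_zero {x : E d} (hx : 1 ≤ ‖x‖) : bump x = 0 :=
  expNegInvGlue.zero_of_nonpos (by nlinarith)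

lemma contDiff_bump {n : ℕ∞} : ContDiff ℝ n (bump : E d → ℝ) :=
  expNegInvGlue.contDiff.comp (contDiff_const.sub (contDiff_norm_sq ℝ))

lemma continuous_bump : Continuous (bump : E d → ℝ) := (contDiff_bump (n := 0)).continuous

lemma hasCompactSupport_bump : HasCompactSupport (bump : E d → ℝ) :=
  HasCompactSupport.intro (isCompact_closedBall (0 : E d) 1) fun x hx =>
    bump_eq_zero (by simpa using (not_le.1 (fun h => hx (mem_closedBall_zero_iff.2 h))).le)

lemma hasFDerivAt_bump (x : E d) :
    HasFDerivAt bump (deriv expNegInvGlue (1 - ‖x‖ ^ 2) • -((2 : ℝ) • innerSL ℝ x)) x := by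
  have h1 : HasFDerivAt (fun y : E d => 1 - ‖y‖ ^ 2) (-((2 : ℝ) • innerSL ℝ x)) x := by
    have := (hasStrictFDerivAt_norm_sq x).hasFDerivAt.const_sub 1
    rwa [ofNat_smul_eq_nsmul]
  exact (differentiable_expNegInvGlue _).hasDerivAt.comp_hasFDerivAt x h1

lemma norm_fderiv_bump_le {B : ℝ} (hB : ∀ y ≤ 1, |deriv expNegInvGlue y| ≤ B) (x : E d) :
    ‖fderiv ℝ bump x‖ ≤ 2 * B := by
  have hB0 : 0 ≤ B := (abs_nonneg _).trans (hB 0 zero_le_one)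
  rw [(hasFDerivAt_bump x).fderiv]
  rcases le_or_gt ‖x‖ 1 with h | h
  · rw [norm_smul, norm_neg, norm_smul, innerSL_apply_norm]
    have := hB (1 - ‖x‖ ^ 2) (by nlinarith [norm_nonneg x])
    rw [Real.norm_eq_abs]
    calc |deriv expNegInvGlue (1 - ‖x‖ ^ 2)| * (‖(2 : ℝ)‖ * ‖x‖)
        ≤ B * (2 * 1) := by
          refine mul_le_mul this ?_ (by positivity) hB0
          simpa using h
      _ = 2 * B := by ring
  · rw [deriv_expNegInvGlue_of_neg (by nlinarith), zero_smul, norm_zero]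
    linarith

lemma fderiv_bump_eq_zero {x : E d} (hx : 1 < ‖x‖) : fderiv ℝ bump x = 0 := by
  rw [(hasFDerivAt_bump x).fderiv, deriv_expNegInvGlue_of_neg (by nlinarith), zero_smul]

lemma abs_bump_sub_le {B : ℝ} (hB : ∀ y ≤ 1, |deriv expNegInvGlue y| ≤ B) (x y : E d) :
    |bump x - bump y| ≤ 2 * B * ‖x - y‖ :=
  convex_univ.norm_image_sub_le_of_norm_fderiv_le
    (fun z _ => (hasFDerivAt_bump z).differentiableAt) (fun z _ => norm_fderiv_bump_le hB z)
    (mem_univ y) (mem_univ x)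

lemma integrable_bump_mul (u : E d) : Integrable (fun x : E d => bump x * bump (u - x)) := by
  refine Continuous.integrable_of_hasCompactSupport ?_ hasCompactSupport_bump.mul_right
  exact continuous_bump.mul (continuous_bump.comp (continuous_const.sub continuous_id))

/-- The autocorrelation of the bump. -/
noncomputable def bumpCorr (u : E d) : ℝ := ∫ x : E d, bump x * bump (u - x)

lemma bumpCorr_nonneg (u : E d) : 0 ≤ bumpCorr u :=
  integral_nonneg fun _ => mul_nonneg (bump_nonneg _) (bump_nonneg _)

lemma bumpCorr_eq_zero {u : E d} (hu : 2 ≤ ‖u‖) : bumpCorr u = 0 := by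
  refine integral_eq_zero_of_ae (Filter.Eventually.of_forall fun x => ?_)
  rcases le_or_gt 1 ‖x‖ with h | h
  · simp [bump_eq_zero h]
  · have : 1 ≤ ‖u - x‖ := by linarith [norm_sub_norm_le u x]
    simp [bump_eq_zero this]

lemma integral_bump_sub_mul_bump_sub (θ w : E d) :
    ∫ x, bump (x - θ) * bump (x - w) = bumpCorr (θ - w) := by
  rw [← integral_add_right_eq_self _ w]
  refine integral_congr_ae (Filter.Eventually.of_forall fun x => ?_)
  simp only [add_sub_cancel_right]
  rw [bump_sub_comm, mul_comm]
  congr 2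
  abel

/-- The reflection exchanging u and v preserves both the bump and Lebesgue measure. This makes the
potential radial. -/
lemma bumpCorr_eq_of_norm_eq {u v : E d} (h : ‖u‖ = ‖v‖) : bumpCorr u = bumpCorr v := by
  set e : E d ≃ₗᵢ[ℝ] E d := (Submodule.span ℝ {u - v})ᗮ.reflection with he
  have hev : e u = v := Submodule.reflection_sub h
  have hbump : ∀ x : E d, bump (e x) = bump x := fun x => by
    simp only [bump, LinearIsometryEquiv.norm_map]
  calc bumpCorr u = ∫ x, bump (e x) * bump (v - e x) := by
        refine integral_congr_ae (Filter.Eventually.of_forall fun x => ?_)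
        simp only
        rw [← hev, ← map_sub, hbump, hbump]
    _ = bumpCorr v := e.measurePreserving.integral_comp e.toHomeomorph.measurableEmbedding
        (fun x => bump x * bump (v - x))

/-- Integrating over the midpoint z of the two centres gives the symmetric form that
`expNegInvGlue_mul_le` handles. -/
lemma bumpCorr_two_smul (v : E d) : bumpCorr ((2 : ℝ) • v) = ∫ z, bump (z + v) * bump (z - v) := by
  rw [bumpCorr, ← integral_add_right_eq_self _ v]
  refine integral_congr_ae (Filter.Eventually.of_forall fun x => ?_)
  simp only
  rw [bump_sub_comm x v]
  congr 2
  rw [two_smul]; abel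

/-- The inequality holds pointwise in the midpoint z, hence after integration. This decay along rays
is the source of the drift. -/
lemma bumpCorr_smul_le (v : E d) {t t' : ℝ} (ht : 0 ≤ t) (htt : t ≤ t') :
    bumpCorr (t' • v) ≤ Real.exp (-((t' ^ 2 - t ^ 2) * (‖v‖ ^ 2 / 4))) * bumpCorr (t • v) := by
  have key : ∀ s : ℝ, s • v = (2 : ℝ) • ((s / 2) • v) := fun s => by
    rw [smul_smul]; congr 1; ring
  rw [key t, key t', bumpCorr_two_smul, bumpCorr_two_smul, ← integral_const_mul]
  have hint : ∀ a : E d, Integrable (fun z : E d => bump (z + a) * bump (z - a)) := fun a => by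
    have := (integrable_bump_mul ((2 : ℝ) • a)).comp_add_right a
    refine this.congr (Filter.Eventually.of_forall fun x => ?_)
    simp only
    rw [bump_sub_comm x a]
    congr 2
    rw [two_smul]; abel
  refine integral_mono (hint _) ((hint _).const_mul _) fun z => ?_
  have hexp : ∀ s : ℝ, bump (z + (s / 2) • v) * bump (z - (s / 2) • v) =
      expNegInvGlue (1 - ((‖z‖ ^ 2 + s ^ 2 * (‖v‖ ^ 2 / 4)) + s * inner ℝ z v)) *
      expNegInvGlue (1 - ((‖z‖ ^ 2 + s ^ 2 * (‖v‖ ^ 2 / 4)) - s * inner ℝ z v)) := by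
    intro s
    unfold bump
    rw [norm_add_sq_real, norm_sub_sq_real, norm_smul, inner_smul_right, mul_pow,
      Real.norm_eq_abs, sq_abs]
    congr 2 <;> ring
  simp only
  rw [hexp, hexp]
  -- Here ‖z ± (s/2)v‖² = A ± B. The condition |B| ≤ A is Cauchy–Schwarz followed by the inequality
  -- of arithmetic and geometric means.
  have := expNegInvGlue_mul_le (A := ‖z‖ ^ 2 + t ^ 2 * (‖v‖ ^ 2 / 4))
    (A' := ‖z‖ ^ 2 + t' ^ 2 * (‖v‖ ^ 2 / 4)) (B := t * inner ℝ z v) (B' := t' * inner ℝ z v)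
    (by gcongr) (by rw [abs_mul, abs_mul, abs_of_nonneg ht, abs_of_nonneg (ht.trans htt)]; gcongr)
    (by
      rw [abs_mul, abs_of_nonneg ht]
      have := abs_real_inner_le_norm z v
      nlinarith [sq_nonneg (‖z‖ - t * ‖v‖ / 2), mul_le_mul_of_nonneg_left this ht])
  refine this.trans (le_of_eq ?_)
  congr 2
  ring

lemma bumpCorr_le_bumpCorr_zero (u : E d) : bumpCorr u ≤ bumpCorr (0 : E d) := by
  have := bumpCorr_smul_le u (t := 0) (t' := 1) le_rfl zero_le_one
  rw [one_smul, zero_smul] at this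
  refine this.trans (mul_le_of_le_one_left (bumpCorr_nonneg 0) (Real.exp_le_one_iff.2 ?_))
  have : 0 ≤ ‖u‖ ^ 2 / 4 := by positivity
  nlinarith

/-- The volume of the unit ball. -/
noncomputable def ballVol (d : ℕ) : ℝ := volume.real (Metric.closedBall (0 : E d) 1)

lemma ballVol_pos (d : ℕ) : 0 < ballVol d :=
  ENNReal.toReal_pos (Metric.measure_closedBall_pos _ _ one_pos).ne'
    measure_closedBall_lt_top.ne

/-- For x within 1/4 of u/2, both x and u - x have norm at most 3/4, and 7/16 = 1 - (3/4)². Against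
`bumpCorr_zero_le` this costs only a factor exponential in d. -/
lemma le_bumpCorr {u : E d} (hu : ‖u‖ ≤ 1) :
    expNegInvGlue (7 / 16) ^ 2 * (4⁻¹ ^ d * ballVol d) ≤ bumpCorr u := by
  have hsub : ∀ x ∈ Metric.closedBall ((2⁻¹ : ℝ) • u) 4⁻¹,
      expNegInvGlue (7 / 16) ^ 2 ≤ bump x * bump (u - x) := by
    intro x hx
    rw [mem_closedBall_iff_norm] at hx
    have hn : ‖(2⁻¹ : ℝ) • u‖ ≤ 1 / 2 := by rw [norm_smul]; norm_num; linarith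
    have h1 : ‖x‖ ≤ 3 / 4 := by
      have := norm_add_le (x - (2⁻¹ : ℝ) • u) ((2⁻¹ : ℝ) • u)
      rw [sub_add_cancel] at this
      norm_num at hx ⊢; linarith
    have h2 : ‖u - x‖ ≤ 3 / 4 := by
      have := norm_sub_le ((2⁻¹ : ℝ) • u) (x - (2⁻¹ : ℝ) • u)
      have e : (2⁻¹ : ℝ) • u - (x - (2⁻¹ : ℝ) • u) = u - x := by
        have : u = (2⁻¹ : ℝ) • u + (2⁻¹ : ℝ) • u := by rw [← add_smul]; norm_num
        nth_rw 3 [this]; abel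
      rw [e] at this
      norm_num at hx ⊢; linarith
    rw [sq]
    have aux : ∀ y : E d, ‖y‖ ≤ 3 / 4 → expNegInvGlue (7 / 16) ≤ bump y := fun y hy =>
      expNegInvGlue.monotone (by nlinarith [norm_nonneg y])
    exact mul_le_mul (aux _ h1) (aux _ h2) (expNegInvGlue.nonneg _) (bump_nonneg _)
  have hvol : volume.real (Metric.closedBall ((2⁻¹ : ℝ) • u) 4⁻¹) = 4⁻¹ ^ d * ballVol d := by
    rw [ballVol, measureReal_def, measureReal_def, Measure.addHaar_closedBall' _ _ (by norm_num),
      ENNReal.toReal_mul, ENNReal.toReal_ofReal (by positivity), finrank_euclideanSpace_fin]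
  calc expNegInvGlue (7 / 16) ^ 2 * (4⁻¹ ^ d * ballVol d)
      = ∫ _ in Metric.closedBall ((2⁻¹ : ℝ) • u) 4⁻¹, expNegInvGlue (7 / 16) ^ 2 := by
        rw [setIntegral_const, hvol, smul_eq_mul, mul_comm]
    _ ≤ ∫ x in Metric.closedBall ((2⁻¹ : ℝ) • u) 4⁻¹, bump x * bump (u - x) :=
        setIntegral_mono_on (integrableOn_const measure_closedBall_lt_top.ne)
          (integrable_bump_mul u).integrableOn Metric.isClosed_closedBall.measurableSet hsub
    _ ≤ bumpCorr u := setIntegral_le_integral (integrable_bump_mul u)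
        (Filter.Eventually.of_forall fun x => mul_nonneg (bump_nonneg _) (bump_nonneg _))

lemma bumpCorr_zero_pos (d : ℕ) : 0 < bumpCorr (0 : E d) := by
  refine lt_of_lt_of_le ?_ (le_bumpCorr (u := (0 : E d)) (by simp))
  have := ballVol_pos d
  have := expNegInvGlue.pos_of_pos (x := 7 / 16) (by norm_num)
  positivity

lemma bumpCorr_zero_le (d : ℕ) : bumpCorr (0 : E d) ≤ ballVol d := by
  have h : ∀ x : E d, x ∉ Metric.closedBall (0 : E d) 1 → bump x * bump (0 - x) = 0 := by
    intro x hx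
    rw [mem_closedBall_zero_iff, not_le] at hx
    rw [bump_eq_zero hx.le, zero_mul]
  rw [bumpCorr, ← setIntegral_eq_integral_of_forall_compl_eq_zero h]
  calc ∫ x in Metric.closedBall (0 : E d) 1, bump x * bump (0 - x)
      ≤ ∫ _ in Metric.closedBall (0 : E d) 1, (1 : ℝ) :=
        setIntegral_mono_on (integrable_bump_mul 0).integrableOn
          (integrableOn_const measure_closedBall_lt_top.ne)
          Metric.isClosed_closedBall.measurableSet
          fun x _ => mul_le_one₀ (bump_le_one _) (bump_nonneg _) (bump_le_one _)
    _ = ballVol d := by rw [setIntegral_const, smul_eq_mul, mul_one, ballVol]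

/-- The derivative of the autocorrelation. -/
noncomputable def bumpCorrDeriv (u : E d) : E d →L[ℝ] ℝ :=
  ∫ t : E d, bump (u - t) • fderiv ℝ bump t

lemma hasFDerivAt_bumpCorr (u : E d) : HasFDerivAt bumpCorr (bumpCorrDeriv u) u := by
  have h := hasCompactSupport_bump.hasFDerivAt_convolution_left (ContinuousLinearMap.mul ℝ ℝ)
    (μ := (volume : Measure (E d))) (contDiff_bump (d := d) (n := 1))
    (g := bump) continuous_bump.locallyIntegrable u
  convert! h using 1
  rw [bumpCorrDeriv, convolution_def]
  refine integral_congr_ae (Filter.Eventually.of_forall fun t => ?_)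
  ext v
  simp [mul_comm]

lemma continuous_fderiv_bump : Continuous (fderiv ℝ (bump : E d → ℝ)) :=
  (contDiff_bump (n := 1)).continuous_fderiv (by norm_num)

lemma integrable_bump_smul_fderiv (u : E d) :
    Integrable (fun t : E d => bump (u - t) • fderiv ℝ bump t) := by
  refine Continuous.integrable_of_hasCompactSupport ?_ ?_
  · exact (continuous_bump.comp (continuous_const.sub continuous_id)).smul continuous_fderiv_bump
  · refine HasCompactSupport.intro (isCompact_closedBall (0 : E d) 1) fun x hx => ?_
    rw [mem_closedBall_zero_iff, not_le] at hx
    rw [fderiv_bump_eq_zero hx, smul_zero]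

lemma norm_integral_smul_fderiv_bump_le {B : ℝ} (hB : ∀ y ≤ 1, |deriv expNegInvGlue y| ≤ B)
    (f : E d → ℝ) {b : ℝ} (hf : ∀ t, |f t| ≤ b) :
    ‖∫ t, f t • fderiv ℝ bump t‖ ≤ 2 * B * b * ballVol d := by
  have h : ∀ x : E d, x ∉ Metric.closedBall (0 : E d) 1 → f x • fderiv ℝ bump x = 0 := by
    intro x hx
    rw [mem_closedBall_zero_iff, not_le] at hx
    rw [fderiv_bump_eq_zero hx, smul_zero]
  have hI := setIntegral_eq_integral_of_forall_compl_eq_zero (μ := volume) h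
  rw [← hI]
  have hfin : volume (Metric.closedBall (0 : E d) 1) < ⊤ := measure_closedBall_lt_top
  refine (norm_setIntegral_le_of_norm_le_const (C := 2 * B * b) hfin fun t _ => ?_)
  rw [norm_smul, mul_comm]
  exact mul_le_mul (norm_fderiv_bump_le hB t) (hf t) (abs_nonneg _)
    (by linarith [(abs_nonneg _).trans (hB 0 zero_le_one)])

lemma norm_bumpCorrDeriv_le {B : ℝ} (hB : ∀ y ≤ 1, |deriv expNegInvGlue y| ≤ B) (u : E d) :
    ‖bumpCorrDeriv u‖ ≤ 2 * B * ballVol d := by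
  refine (norm_integral_smul_fderiv_bump_le hB (fun t => bump (u - t)) (b := 1)
    fun t => ?_).trans (le_of_eq (by ring))
  rw [abs_of_nonneg (bump_nonneg _)]
  exact bump_le_one _

/-- One factor of the autocorrelation carries the derivative and the other supplies the Lipschitz
bound, so no second derivative of the bump is needed. -/
lemma norm_bumpCorrDeriv_sub_le {B : ℝ} (hB : ∀ y ≤ 1, |deriv expNegInvGlue y| ≤ B) (u v : E d) :
    ‖bumpCorrDeriv u - bumpCorrDeriv v‖ ≤ 4 * B ^ 2 * ballVol d * ‖u - v‖ := by
  rw [bumpCorrDeriv, bumpCorrDeriv,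
    ← integral_sub (integrable_bump_smul_fderiv u) (integrable_bump_smul_fderiv v)]
  simp_rw [← sub_smul]
  refine (norm_integral_smul_fderiv_bump_le hB _ (b := 2 * B * ‖u - v‖) fun t => ?_).trans
    (le_of_eq (by ring))
  simpa using abs_bump_sub_le hB (u - t) (v - t)

/-- By `bumpCorr_smul_le`, exp(t²q) times the autocorrelation at t • u is antitone in t ≥ 0; the
claim is the sign of its derivative at t = 1. -/
lemma bumpCorrDeriv_apply_self_le (u : E d) :
    bumpCorrDeriv u u ≤ -(‖u‖ ^ 2 / 2 * bumpCorr u) := by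
  set q := ‖u‖ ^ 2 / 4 with hq
  have hline : HasDerivAt (fun t : ℝ => t • u) u 1 := by
    simpa using (hasDerivAt_id (1 : ℝ)).smul_const u
  have h1 : HasDerivAt (fun t : ℝ => bumpCorr (t • u)) (bumpCorrDeriv u u) 1 := by
    have := hasFDerivAt_bumpCorr ((1 : ℝ) • u)
    have h := this.comp_hasDerivAt (1 : ℝ) hline
    rwa [one_smul] at h
  have h2 : HasDerivAt (fun t : ℝ => Real.exp (t ^ 2 * q)) (Real.exp q * (2 * q)) 1 := by
    have := (((hasDerivAt_id (1 : ℝ)).pow 2).mul_const q).exp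
    simpa using this
  have h3 := h2.mul h1
  have hanti : AntitoneOn (fun t : ℝ => Real.exp (t ^ 2 * q) * bumpCorr (t • u)) (Ici 0) := by
    intro t ht t' _ htt
    have := bumpCorr_smul_le u ht htt
    calc Real.exp (t' ^ 2 * q) * bumpCorr (t' • u)
        ≤ Real.exp (t' ^ 2 * q) *
          (Real.exp (-((t' ^ 2 - t ^ 2) * q)) * bumpCorr (t • u)) := by gcongr
      _ = Real.exp (t ^ 2 * q) * bumpCorr (t • u) := by
        rw [← mul_assoc, ← Real.exp_add]; congr 2; ring
  have hneg := (h3.hasDerivWithinAt (s := Ici 0)).nonpos_of_antitoneOn ?_ hanti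
  · simp only [one_pow, one_mul, one_smul] at hneg
    have : Real.exp q * (2 * q * bumpCorr u + bumpCorrDeriv u u) ≤ 0 := by
      calc _ = Real.exp q * (2 * q) * bumpCorr u + Real.exp q * bumpCorrDeriv u u := by ring
        _ ≤ 0 := hneg
    have := nonpos_of_mul_nonpos_right this (Real.exp_pos q)
    have : 2 * q * bumpCorr u = ‖u‖ ^ 2 / 2 * bumpCorr u := by rw [hq]; ring
    linarith
  -- The point 1 is interior to [0, ∞), hence an accumulation point of it.
  · exact (accPt_principal_iff_nhdsWithin.2 (by
      have : (nhdsWithin (1 : ℝ) {1}ᶜ).NeBot := inferInstance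
      rw [sdiff_eq, inter_comm, nhdsWithin_inter_of_mem']
      · exact this
      · exact mem_nhdsWithin_of_mem_nhds (Ici_mem_nhds one_pos)))

/-! ### Compactly supported kernels -/

/-- A kernel `φ` with gradient field `G` that is supported in the ball of radius `r`, has an
`M`-Lipschitz gradient of norm at most `M`, decays along rays at rate `c`, and is at least `κ` on
the ball of radius `r / 2`. -/
structure IsLocalKernel {d : ℕ} (φ : E d → ℝ) (G : E d → E d) (r M c κ : ℝ) : Prop where
  map_zero : φ 0 = 1
  nonneg : ∀ u, 0 ≤ φ u
  le_one : ∀ u, φ u ≤ 1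
  support : ∀ u, r ≤ ‖u‖ → φ u = 0
  hasGradientAt : ∀ u, HasGradientAt φ (G u) u
  lipschitz : ∀ u v, ‖G u - G v‖ ≤ M * ‖u - v‖
  norm_le : ∀ u, ‖G u‖ ≤ M
  drift : ∀ u, inner ℝ (G u) u ≤ -(c * ‖u‖ ^ 2 * φ u)
  lower : ∀ u, ‖u‖ ≤ r / 2 → κ ≤ φ u

/-- The normalised autocorrelation of a bump, scaled to have support of radius `d`. -/
noncomputable def kernel (d : ℕ) (u : E d) : ℝ := bumpCorr ((2 / d : ℝ) • u) / bumpCorr (0 : E d)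

/-- The rescaling factor 2/d is at most 1, so the only large constant comes from normalising:
`ballVol d` over the autocorrelation at 0 is at most 4^d/κ. The drift rate is (2/d)²/2. -/
lemma exists_isLocalKernel :
    ∃ A : ℝ, 1 ≤ A ∧ ∀ d : ℕ, 2 ≤ d → ∃ G : E d → E d,
      IsLocalKernel (kernel d) G d (A * 4 ^ d) (2 / d ^ 2) (A⁻¹ * 4⁻¹ ^ d) := by
  obtain ⟨B, hB1, hB⟩ := exists_abs_deriv_expNegInvGlue_le
  set κ := expNegInvGlue (7 / 16) ^ 2 with hκ
  have hκ0 : 0 < κ := pow_pos (expNegInvGlue.pos_of_pos (by norm_num)) 2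
  have hκ1 : κ ≤ 1 := pow_le_one₀ (expNegInvGlue.nonneg _) (expNegInvGlue_le_one _)
  -- The Lipschitz constant 4B² of the gradient, divided by the κ of the normalisation; it also
  -- dominates the other constants.
  refine ⟨4 * B ^ 2 / κ, ?_, fun d hd => ?_⟩
  · rw [le_div_iff₀ hκ0]; nlinarith
  set N := bumpCorr (0 : E d) with hN
  have hN0 : 0 < N := bumpCorr_zero_pos d
  have hV0 := ballVol_pos d
  have hNlow : κ * (4⁻¹ ^ d * ballVol d) ≤ N := le_bumpCorr (by simp)
  have hVN : ballVol d / N ≤ 4 ^ d / κ := by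
    rw [div_le_div_iff₀ hN0 hκ0]
    have h4 : (4 : ℝ) ^ d * 4⁻¹ ^ d = 1 := by rw [← mul_pow]; norm_num
    calc ballVol d * κ = 4 ^ d * (κ * (4⁻¹ ^ d * ballVol d)) := by
          linear_combination (-(ballVol d * κ)) * h4
      _ ≤ 4 ^ d * N := by gcongr
  have hd2 : (2 : ℝ) ≤ d := by exact_mod_cast hd
  set c : ℝ := 2 / d with hc
  have hc0 : 0 < c := by positivity
  have hc1 : c ≤ 1 := by rw [hc, div_le_one (by linarith)]; exact hd2
  set J := (InnerProductSpace.toDual ℝ (E d)).symm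
  have hinner : ∀ (f : E d →L[ℝ] ℝ) (v : E d), inner ℝ (J f) v = f v := fun f v =>
    InnerProductSpace.toDual_symm_apply
  refine ⟨fun u => (c / N) • J (bumpCorrDeriv (c • u)),
    ⟨?_, fun u => ?_, fun u => ?_, fun u hu => ?_, fun u => ?_, fun u v => ?_, fun u => ?_,
      fun u => ?_, fun u hu => ?_⟩⟩
  · rw [kernel, smul_zero, div_self hN0.ne']
  · exact div_nonneg (bumpCorr_nonneg _) hN0.le
  · exact div_le_one_of_le₀ (bumpCorr_le_bumpCorr_zero _) hN0.le
  · rw [kernel, bumpCorr_eq_zero, zero_div]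
    rw [norm_smul, Real.norm_of_nonneg hc0.le]
    calc (2 : ℝ) = c * d := by rw [hc]; field_simp
      _ ≤ c * ‖u‖ := by gcongr
  · rw [hasGradientAt_iff_hasFDerivAt]
    have h1 : HasFDerivAt (fun u : E d => c • u) (c • ContinuousLinearMap.id ℝ (E d)) u :=
      (hasFDerivAt_id u).const_smul c
    have h2 := ((hasFDerivAt_bumpCorr (c • u)).comp u h1).const_mul N⁻¹
    have h3 : (fun u : E d => N⁻¹ * (bumpCorr ∘ fun u => c • u) u) = kernel d := by
      ext v; rw [kernel, div_eq_inv_mul]; rfl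
    rw [h3] at h2
    convert! h2 using 1
    ext v
    rw [InnerProductSpace.toDual_apply_apply, inner_smul_left, hinner]
    simp
    ring
  · calc ‖(c / N) • J (bumpCorrDeriv (c • u)) - (c / N) • J (bumpCorrDeriv (c • v))‖
        = c / N * ‖bumpCorrDeriv (c • u) - bumpCorrDeriv (c • v)‖ := by
          rw [← smul_sub, ← map_sub, norm_smul, LinearIsometryEquiv.norm_map,
            Real.norm_of_nonneg (by positivity)]
      _ ≤ c / N * (4 * B ^ 2 * ballVol d * ‖c • u - c • v‖) := by
          gcongr; exact norm_bumpCorrDeriv_sub_le hB _ _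
      _ = c ^ 2 * (4 * B ^ 2 * (ballVol d / N)) * ‖u - v‖ := by
          rw [← smul_sub, norm_smul, Real.norm_of_nonneg hc0.le]; ring
      _ ≤ 1 * (4 * B ^ 2 * (4 ^ d / κ)) * ‖u - v‖ := by
          gcongr; exact pow_le_one₀ hc0.le hc1
      _ = _ := by ring
  · calc ‖(c / N) • J (bumpCorrDeriv (c • u))‖ = c / N * ‖bumpCorrDeriv (c • u)‖ := by
          rw [norm_smul, LinearIsometryEquiv.norm_map, Real.norm_of_nonneg (by positivity)]
      _ ≤ c / N * (2 * B * ballVol d) := by gcongr; exact norm_bumpCorrDeriv_le hB _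
      _ = c * (2 * B * (ballVol d / N)) := by ring
      _ ≤ 1 * (4 * B ^ 2 * (4 ^ d / κ)) := by
          gcongr ?_ * (?_ * ?_); nlinarith
      _ = _ := by ring
  · have := bumpCorrDeriv_apply_self_le (c • u)
    rw [inner_smul_left, hinner, kernel]
    rw [map_smul, smul_eq_mul, norm_smul, Real.norm_of_nonneg hc0.le] at this
    have hc2 : (2 : ℝ) / d ^ 2 = c ^ 2 / 2 := by rw [hc]; field_simp
    rw [hc2]
    calc c / N * bumpCorrDeriv (c • u) u = N⁻¹ * (c * bumpCorrDeriv (c • u) u) := by ring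
      _ ≤ N⁻¹ * -((c * ‖u‖) ^ 2 / 2 * bumpCorr (c • u)) := by gcongr
      _ = _ := by ring
  · have hu1 : ‖c • u‖ ≤ 1 := by
      rw [norm_smul, Real.norm_of_nonneg hc0.le]
      calc c * ‖u‖ ≤ c * (d / 2) := by gcongr
        _ = 1 := by rw [hc]; field_simp
    rw [kernel, le_div_iff₀ hN0]
    have hAκ : (4 * B ^ 2 / κ)⁻¹ ≤ κ := by
      rw [inv_div, div_le_iff₀ (by positivity)]
      exact le_mul_of_one_le_right hκ0.le (by nlinarith)
    calc (4 * B ^ 2 / κ)⁻¹ * 4⁻¹ ^ d * bumpCorr (0 : E d)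
        ≤ κ * 4⁻¹ ^ d * ballVol d := by
          gcongr; exact bumpCorr_zero_le d
      _ = κ * (4⁻¹ ^ d * ballVol d) := by ring
      _ ≤ _ := le_bumpCorr hu1

/-! ### The Gaussian density and the activation -/

/-- The density of the standard Gaussian distribution. -/
noncomputable def gaussDensity {d : ℕ} (x : E d) : ℝ :=
  (2 * Real.pi) ^ (-(d / 2 : ℝ)) * Real.exp (-(1 / 2) * ‖x‖ ^ 2)

section

variable {d : ℕ}

lemma gaussDensity_pos (x : E d) : 0 < gaussDensity x := by
  unfold gaussDensity; positivity

lemma continuous_gaussDensity : Continuous (gaussDensity : E d → ℝ) := by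
  unfold gaussDensity; fun_prop

/-- Otherwise the Bochner integral would be 0 by convention, contradicting its known positive value.
-/
lemma integrable_exp_neg_mul_sq_norm {b : ℝ} (hb : 0 < b) :
    Integrable (fun x : E d => Real.exp (-b * ‖x‖ ^ 2)) := by
  by_contra h
  have h1 := GaussianFourier.integral_rexp_neg_mul_sq_norm (V := E d) hb
  rw [integral_undef h] at h1
  have : 0 < (Real.pi / b) ^ (Module.finrank ℝ (E d) / 2 : ℝ) :=
    Real.rpow_pos_of_pos (div_pos Real.pi_pos hb) _
  linarith

/-- Both sides are finite measures with the same characteristic function. -/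
lemma stdGaussian_eq_withDensity :
    stdGaussian (E d) = volume.withDensity fun x => ENNReal.ofReal (gaussDensity x) := by
  have hint : Integrable (gaussDensity : E d → ℝ) :=
    (integrable_exp_neg_mul_sq_norm (by norm_num)).const_mul _
  have : IsFiniteMeasure ((volume : Measure (E d)).withDensity
      fun x => ENNReal.ofReal (gaussDensity x)) :=
    isFiniteMeasure_withDensity_ofReal hint.2
  refine Measure.ext_of_charFun ?_
  ext t
  rw [charFun_stdGaussian, charFun_apply,
    integral_withDensity_eq_integral_toReal_smul
      (continuous_gaussDensity.measurable.ennreal_ofReal) (by simp)]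
  have hcongr : ∀ x : E d, (ENNReal.ofReal (gaussDensity x)).toReal •
      Complex.exp (inner ℝ x t * Complex.I) =
      (((2 * Real.pi) ^ (-(d / 2 : ℝ)) : ℝ) : ℂ) *
        Complex.exp (-(1 / 2 : ℂ) * ‖x‖ ^ 2 + Complex.I * inner ℝ t x) := by
    intro x
    rw [ENNReal.toReal_ofReal (gaussDensity_pos x).le, gaussDensity, Complex.real_smul,
      Complex.ofReal_mul, mul_assoc, Complex.ofReal_exp, ← Complex.exp_add, real_inner_comm]
    push_cast
    congr 2
    ring
  simp_rw [hcongr]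
  rw [integral_const_mul, GaussianFourier.integral_cexp_neg_mul_sq_norm_add (by norm_num)]
  have h2 : ((Real.pi : ℂ) / (1 / 2)) = ((2 * Real.pi : ℝ) : ℂ) := by push_cast; ring
  rw [h2, finrank_euclideanSpace_fin, ← mul_assoc]
  have h3 : (((2 * Real.pi) ^ (-(d / 2 : ℝ)) : ℝ) : ℂ) *
      ((2 * Real.pi : ℝ) : ℂ) ^ ((d : ℂ) / 2) = 1 := by
    have : ((d : ℂ) / 2) = ((d / 2 : ℝ) : ℂ) := by push_cast; ring
    rw [this, ← Complex.ofReal_cpow (by positivity), ← Complex.ofReal_mul,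
      ← Real.rpow_add (by positivity)]
    simp
  rw [h3, one_mul, Complex.I_sq]
  congr 1
  ring

lemma integral_stdGaussian (f : E d → ℝ) :
    ∫ x, f x ∂(stdGaussian (E d)) = ∫ x, gaussDensity x * f x := by
  rw [stdGaussian_eq_withDensity, integral_withDensity_eq_integral_toReal_smul
      (continuous_gaussDensity.measurable.ennreal_ofReal) (by simp)]
  simp_rw [ENNReal.toReal_ofReal (gaussDensity_pos _).le, smul_eq_mul]

lemma integrable_stdGaussian_iff {f : E d → ℝ} :
    Integrable f (stdGaussian (E d)) ↔ Integrable (fun x => gaussDensity x * f x) := by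
  rw [stdGaussian_eq_withDensity, integrable_withDensity_iff_integrable_smul'
      (continuous_gaussDensity.measurable.ennreal_ofReal) (by simp)]
  simp_rw [ENNReal.toReal_ofReal (gaussDensity_pos _).le, smul_eq_mul]

end

/-- The activation with potential `kernel d`. -/
noncomputable def activation (d : ℕ) (x θ : E d) : ℝ :=
  bump (x - (2 / d : ℝ) • θ) / √(bumpCorr (0 : E d) * gaussDensity x)

section

variable {d : ℕ}

lemma measurable_activation : Measurable (Function.uncurry (activation d)) := by
  refine Measurable.div (continuous_bump.measurable.comp (by fun_prop)) ?_
  exact (((continuous_gaussDensity.measurable).comp measurable_fst).const_mul _).sqrt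

/-- The two square roots in the denominators multiply to the density and cancel it, leaving a
translation-invariant Lebesgue integrand. -/
lemma gaussDensity_mul_activation_mul (x θ w : E d) :
    gaussDensity x * (activation d x θ * activation d x w) =
      (bumpCorr (0 : E d))⁻¹ * (bump (x - (2 / d : ℝ) • θ) * bump (x - (2 / d : ℝ) • w)) := by
  have hN := bumpCorr_zero_pos d
  have hρ := gaussDensity_pos x
  have hs := Real.mul_self_sqrt (mul_pos hN hρ).le
  unfold activation
  rw [div_mul_div_comm, hs]
  field_simp

lemma potential_activation (θ w : E d) : potential (activation d) θ w = kernel d (θ - w) := by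
  rw [potential, integral_stdGaussian]
  simp_rw [gaussDensity_mul_activation_mul]
  rw [integral_const_mul, integral_bump_sub_mul_bump_sub, kernel, smul_sub]
  exact (div_eq_inv_mul _ _).symm

lemma memLp_activation (w : E d) :
    MemLp (fun x => activation d x w) 2 (stdGaussian (E d)) := by
  have hm : Measurable fun x => activation d x w := measurable_activation.of_uncurry_right
  rw [memLp_two_iff_integrable_sq hm.aestronglyMeasurable, integrable_stdGaussian_iff]
  simp_rw [sq, gaussDensity_mul_activation_mul]
  refine Integrable.const_mul ?_ _
  refine Continuous.integrable_of_hasCompactSupport ?_ ?_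
  · exact (continuous_bump.comp (by fun_prop)).mul (continuous_bump.comp (by fun_prop))
  · refine HasCompactSupport.intro
      (isCompact_closedBall ((2 / d : ℝ) • w) 1) fun x hx => ?_
    rw [mem_closedBall_iff_norm, not_le] at hx
    rw [bump_eq_zero hx.le, zero_mul]

lemma isActivation_activation (hd : d ≠ 0) : IsActivation (activation d) := by
  refine ⟨measurable_activation, memLp_activation, ?_⟩
  set e : E d := EuclideanSpace.single ⟨0, Nat.pos_of_ne_zero hd⟩ 1 with he
  have hn : ‖e‖ = 1 := by simp [he]
  refine ⟨fun r => kernel d (r • e), ?_, fun θ w => ?_⟩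
  · simp only
    rw [zero_smul, kernel, smul_zero, div_self (bumpCorr_zero_pos d).ne']
  · rw [potential_activation]
    simp only [kernel]
    congr 1
    refine bumpCorr_eq_of_norm_eq ?_
    simp [norm_smul, hn]

end

/-! ### The loss as a function of one node -/

section

variable {d k : ℕ}

/-- The superposition at `θ` of translates of `φ`, centred at the current nodes and the target
nodes and weighted by their output weights. -/
noncomputable def field {V : Type*} [AddCommGroup V] [Module ℝ V] (φ : E d → V) (w : Fin k → E d)
    (b : Fin k → ℝ) (p : Params d k) (θ : E d) : V :=
  ∑ i, p.1 i • φ (θ - p.2 i) + ∑ j, b j • φ (θ - w j)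

variable {σ : E d → E d → ℝ} {φ : E d → ℝ} {w : Fin k → E d} {b : Fin k → ℝ}

lemma memLp_residual (hσ : ∀ w, MemLp (fun x => σ x w) 2 (stdGaussian (E d))) (p : Params d k) :
    MemLp (fun x => ∑ i, p.1 i * σ x (p.2 i) + ∑ j, b j * σ x (w j)) 2 (stdGaussian (E d)) :=
  (memLp_finsetSum _ fun i _ => (hσ (p.2 i)).const_mul (p.1 i)).add
    (memLp_finsetSum _ fun j _ => (hσ (w j)).const_mul (b j))

/-- A node with zero output weight contributes nothing, so inserting (a, θ) adds aσ(·, θ) to the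
residual. The cross term is the field, and the coefficient of a² is Φ(θ, θ) = 1. -/
lemma loss_setNode (hσ : ∀ w, MemLp (fun x => σ x w) 2 (stdGaussian (E d)))
    (hφ : ∀ θ w, potential σ θ w = φ (θ - w)) (hφ0 : φ 0 = 1) {p : Params d k} {i : Fin k}
    (hp : p.1 i = 0) (x : Node d) :
    loss σ w b (setNode p i x) =
      loss σ w b p + 2 * x.fst * field φ w b p x.snd + x.fst ^ 2 := by
  have hI : ∀ θ θ', Integrable (fun y => σ y θ * σ y θ') (stdGaussian (E d)) := fun θ θ' =>
    (hσ θ).integrable_mul (hσ θ')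
  have hsum : ∀ y, ∑ i', (setNode p i x).1 i' * σ y ((setNode p i x).2 i') =
      x.fst * σ y x.snd + ∑ i', p.1 i' * σ y (p.2 i') := by
    intro y
    rw [← Finset.add_sum_erase _ _ (Finset.mem_univ i),
      ← Finset.add_sum_erase _ (fun i' => p.1 i' * σ y (p.2 i')) (Finset.mem_univ i), hp]
    simp only [setNode, Function.update_self, zero_mul, zero_add]
    congr 1
    refine Finset.sum_congr rfl fun i' hi' => ?_
    rw [Function.update_of_ne (Finset.ne_of_mem_erase hi'),
      Function.update_of_ne (Finset.ne_of_mem_erase hi')]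
  have hr := memLp_residual (w := w) (b := b) hσ p
  set r := fun y => ∑ i, p.1 i * σ y (p.2 i) + ∑ j, b j * σ y (w j) with hrdef
  have hcross : ∫ y, σ y x.snd * r y ∂(stdGaussian (E d)) = field φ w b p x.snd := by
    have : ∀ y, σ y x.snd * r y = ∑ i, p.1 i * (σ y x.snd * σ y (p.2 i)) +
        ∑ j, b j * (σ y x.snd * σ y (w j)) := by
      intro y
      rw [hrdef]
      simp only
      rw [mul_add, Finset.mul_sum, Finset.mul_sum]
      congr 1 <;> exact Finset.sum_congr rfl fun _ _ => by ring
    simp_rw [this]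
    rw [integral_add (integrable_finsetSum _ fun i _ => (hI _ _).const_mul _)
      (integrable_finsetSum _ fun i _ => (hI _ _).const_mul _),
      integral_finsetSum _ fun i _ => (hI _ _).const_mul _,
      integral_finsetSum _ fun i _ => (hI _ _).const_mul _]
    simp_rw [integral_const_mul]
    simp_rw [field, smul_eq_mul, ← hφ, potential]
  have hself : ∫ y, σ y x.snd * σ y x.snd ∂(stdGaussian (E d)) = 1 := by
    rw [← hφ0, ← sub_self x.snd, ← hφ, potential]
  have hexp : ∀ y, (∑ i', (setNode p i x).1 i' * σ y ((setNode p i x).2 i') +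
      ∑ j, b j * σ y (w j)) ^ 2 =
      r y ^ 2 + 2 * x.fst * (σ y x.snd * r y) + x.fst ^ 2 * (σ y x.snd * σ y x.snd) := by
    intro y; rw [hsum, hrdef]; ring
  rw [loss]
  simp_rw [hexp]
  have i1 : Integrable (fun y => r y ^ 2) (stdGaussian (E d)) := hr.integrable_sq
  have i3 : Integrable (fun y => x.fst ^ 2 * (σ y x.snd * σ y x.snd)) (stdGaussian (E d)) :=
    (hI _ _).const_mul _
  have i2 : Integrable (fun y => 2 * x.fst * (σ y x.snd * r y)) (stdGaussian (E d)) :=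
    ((hσ x.snd).integrable_mul hr).const_mul _
  have i12 : Integrable (fun y => r y ^ 2 + 2 * x.fst * (σ y x.snd * r y))
    (stdGaussian (E d)) := i1.add i2
  rw [integral_add i12 i3, integral_add i1 i2, integral_const_mul, integral_const_mul, hcross, hself, mul_one, loss]

lemma loss_nonneg (p : Params d k) : 0 ≤ loss σ w b p :=
  integral_nonneg fun _ => sq_nonneg _

/-- Cauchy–Schwarz and (u + v)² ≤ 2u² + 2v² give 10k²; the weaker 16k² has the convenient root 4k.
-/
lemma loss_le (hσ : ∀ w, MemLp (fun x => σ x w) 2 (stdGaussian (E d)))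
    (hφ : ∀ θ w, potential σ θ w = φ (θ - w)) (hφ0 : φ 0 = 1) {p : Params d k}
    (hp : ∀ i, |p.1 i| ≤ 2) (hb : ∀ j, |b j| ≤ 1) : loss σ w b p ≤ 16 * (k : ℝ) ^ 2 := by
  have hI : ∀ θ, Integrable (fun y => σ y θ ^ 2) (stdGaussian (E d)) := fun θ =>
    (hσ θ).integrable_sq
  have hself : ∀ θ, ∫ y, σ y θ ^ 2 ∂(stdGaussian (E d)) = 1 := fun θ => by
    simp_rw [sq]
    rw [← hφ0, ← sub_self θ, ← hφ, potential]
  have hle : ∀ y, (∑ i, p.1 i * σ y (p.2 i) + ∑ j, b j * σ y (w j)) ^ 2 ≤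
      8 * k * ∑ i, σ y (p.2 i) ^ 2 + 2 * k * ∑ j, σ y (w j) ^ 2 := by
    intro y
    have h1 : (∑ i, p.1 i * σ y (p.2 i)) ^ 2 ≤ k * ∑ i, 4 * σ y (p.2 i) ^ 2 := by
      refine sq_sum_le_card_mul_sum_sq.trans ?_
      rw [Finset.card_univ, Fintype.card_fin]
      gcongr with i
      rw [mul_pow]
      gcongr
      rw [← sq_abs]
      nlinarith [hp i, abs_nonneg (p.1 i)]
    have h2 : (∑ j, b j * σ y (w j)) ^ 2 ≤ k * ∑ j, σ y (w j) ^ 2 := by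
      refine sq_sum_le_card_mul_sum_sq.trans ?_
      rw [Finset.card_univ, Fintype.card_fin]
      refine mul_le_mul_of_nonneg_left (Finset.sum_le_sum fun j _ => ?_) (Nat.cast_nonneg k)
      rw [mul_pow]
      refine mul_le_of_le_one_left (sq_nonneg _) ?_
      rw [← sq_abs]
      nlinarith [hb j, abs_nonneg (b j)]
    rw [← Finset.mul_sum] at h1
    nlinarith [sq_nonneg (∑ i, p.1 i * σ y (p.2 i) - ∑ j, b j * σ y (w j))]
  have i1 : Integrable (fun y => ∑ i, σ y (p.2 i) ^ 2) (stdGaussian (E d)) :=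
    integrable_finsetSum _ fun i _ => hI _
  have i2 : Integrable (fun y => ∑ j, σ y (w j) ^ 2) (stdGaussian (E d)) :=
    integrable_finsetSum _ fun i _ => hI _
  refine (integral_mono (memLp_residual hσ p).integrable_sq
    ((i1.const_mul _).add (i2.const_mul _)) hle).trans ?_
  simp only [Pi.add_apply]
  rw [integral_add (i1.const_mul _) (i2.const_mul _), integral_const_mul, integral_const_mul,
    integral_finsetSum _ fun i _ => hI _, integral_finsetSum _ fun i _ => hI _]
  simp_rw [hself]
  simp only [Finset.sum_const, Finset.card_univ, Fintype.card_fin, nsmul_eq_mul, mul_one]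
  nlinarith [sq_nonneg (k : ℝ)]

lemma isMinOn_loss_permutedTarget (π : Equiv.Perm (Fin k)) :
    IsMinOn (loss σ w b) univ (permutedTarget w b π) := by
  intro p _
  have h0 : loss σ w b (permutedTarget w b π) = 0 := by
    have h : ∀ y, ∑ i, (permutedTarget w b π).1 i * σ y ((permutedTarget w b π).2 i) +
        ∑ j, b j * σ y (w j) = 0 := by
      intro y
      rw [← Equiv.sum_comp π fun j => b j * σ y (w j), ← Finset.sum_add_distrib]
      exact Finset.sum_eq_zero fun i _ => by simp [permutedTarget]
    simp_rw [loss, h]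
    simp
  simpa [h0] using loss_nonneg p

end

/-! ### Termination of `SecondGD` -/

/-- Every accepted step lowers f by more than the threshold, so a nonnegative f rules out exhausting
the T iterations. A gradient step from a point with gradient at least η is always accepted, so
stopping occurs only below η. The strict inequality in `hstep` matters, because a decrease equal to
the threshold stops the algorithm. Accepted steps stay in the sublevel set f ≤ B, where alone
`hstep` is assumed. -/
lemma secondGD_spec {H : Type*} [NormedAddCommGroup H] [InnerProductSpace ℝ H] [CompleteSpace H]
    {f : H → ℝ} {v : (H →L[ℝ] H) → H} {α η γ B : ℝ} (hf : ∀ x, 0 ≤ f x)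
    (hm : 0 ≤ min (α * η ^ 2 / 2) (α ^ 2 * γ ^ 3 / 2))
    (hstep : ∀ x, f x ≤ B → η ≤ ‖gradient f x‖ →
      f (x - α • gradient f x) < f x - α * η ^ 2 / 2) :
    ∀ (T : ℕ) (x : H), f x ≤ B → f x < T * min (α * η ^ 2 / 2) (α ^ 2 * γ ^ 3 / 2) →
      f (secondGD f v x T α η γ) ≤ f x ∧ ‖gradient f (secondGD f v x T α η γ)‖ < η := by
  set m := min (α * η ^ 2 / 2) (α ^ 2 * γ ^ 3 / 2) with hmdef
  have hmle : m ≤ α * η ^ 2 / 2 := min_le_left _ _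
  intro T
  induction T with
  | zero => intro x _ hx; simp at hx; exact absurd hx (not_lt.2 (hf x))
  | succ T ih =>
    intro x hxB hx
    simp only [secondGD]
    split_ifs with h1 h2 h3
    · have := hstep x hxB h1; linarith
    · push Not at h2
      have hy := ih _ ((h2.trans_le (by linarith)).le.trans hxB)
        (by push_cast at hx; linarith)
      exact ⟨hy.1.trans (by linarith), hy.2⟩
    · exact ⟨le_rfl, not_le.1 h1⟩
    · push Not at h3
      have hy := ih _ ((h3.trans_le (by linarith)).le.trans hxB)
        (by push_cast at hx; linarith)
      exact ⟨hy.1.trans (by linarith), hy.2⟩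

/-! ### The objective of a single node -/

section

variable {d : ℕ}

/-- The objective of a node in the potential `F`. -/
noncomputable def nodeQuad (A : ℝ) (F : E d → ℝ) (x : Node d) : ℝ :=
  A + 2 * x.fst * F x.snd + x.fst ^ 2

lemma nodeQuad_zero (A : ℝ) (F : E d → ℝ) : nodeQuad A F 0 = A := by simp [nodeQuad]

/-- Completing the square in the output weight: a loss well below A forces |F| to be large. -/
lemma sub_sq_le_nodeQuad (A : ℝ) (F : E d → ℝ) (x : Node d) :
    A - F x.snd ^ 2 ≤ nodeQuad A F x := by
  unfold nodeQuad; nlinarith [sq_nonneg (x.fst + F x.snd)]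

/-- The gradient of `nodeQuad`. -/
noncomputable def nodeQuadGrad (F : E d → ℝ) (G : E d → E d) (x : Node d) : Node d :=
  WithLp.toLp 2 (2 * (x.fst + F x.snd), (2 * x.fst) • G x.snd)

lemma hasGradientAt_nodeQuad {A : ℝ} {F : E d → ℝ} {G : E d → E d}
    (hG : ∀ θ, HasGradientAt F (G θ) θ) (x : Node d) :
    HasGradientAt (nodeQuad A F) (nodeQuadGrad F G x) x := by
  rw [hasGradientAt_iff_hasFDerivAt]
  have h1 : HasFDerivAt (fun y : Node d => y.fst) (WithLp.fstL 2 ℝ ℝ (E d)) x :=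
    (WithLp.fstL 2 ℝ ℝ (E d)).hasFDerivAt
  have h2 : HasFDerivAt (fun y : Node d => y.snd) (WithLp.sndL 2 ℝ ℝ (E d)) x :=
    (WithLp.sndL 2 ℝ ℝ (E d)).hasFDerivAt
  have h3 := (hG x.snd).hasFDerivAt.comp x h2
  have h4 := (((h1.const_mul 2).mul h3).const_add A).add (h1.pow 2)
  convert! h4 using 1
  ext y
  rw [InnerProductSpace.toDual_apply_apply, WithLp.prod_inner_apply]
  simp [nodeQuadGrad, inner_smul_left]
  ring

lemma abs_sub_inner_le_of_lipschitz_gradient {F : E d → ℝ} {G : E d → E d} {L : ℝ}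
    (hG : ∀ θ, HasGradientAt F (G θ) θ) (hlip : ∀ θ θ', ‖G θ - G θ'‖ ≤ L * ‖θ - θ'‖)
    (hL : 0 ≤ L) (θ θ' : E d) :
    |F θ' - F θ - inner ℝ (G θ) (θ' - θ)| ≤ L * ‖θ' - θ‖ ^ 2 := by
  have := (convex_closedBall θ ‖θ' - θ‖).norm_image_sub_le_of_norm_hasFDerivWithin_le'
    (f := F) (C := L * ‖θ' - θ‖) (φ := InnerProductSpace.toDual ℝ (E d) (G θ))
    (fun x _ => (hG x).hasFDerivAt.hasFDerivWithinAt)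
    (fun x hx => by
      rw [← map_sub, LinearIsometryEquiv.norm_map]
      refine (hlip x θ).trans ?_
      gcongr
      exact mem_closedBall_iff_norm.1 hx)
    (Metric.mem_closedBall_self (norm_nonneg _)) (mem_closedBall_iff_norm.2 le_rfl)
  rw [InnerProductSpace.toDual_apply_apply, Real.norm_eq_abs] at this
  calc _ ≤ _ := this
    _ = _ := by ring

lemma abs_sub_le_of_gradient_le {F : E d → ℝ} {G : E d → E d} {L : ℝ}
    (hG : ∀ θ, HasGradientAt F (G θ) θ) (hbd : ∀ θ, ‖G θ‖ ≤ L) (θ θ' : E d) :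
    |F θ' - F θ| ≤ L * ‖θ' - θ‖ :=
  convex_univ.norm_image_sub_le_of_norm_hasFDerivWithin_le
    (fun x _ => (hG x).hasFDerivAt.hasFDerivWithinAt)
    (fun x _ => by rw [LinearIsometryEquiv.norm_map]; exact hbd x) (mem_univ _) (mem_univ _)

/-- The objective has no globally Lipschitz gradient, as its θ-part scales with a. On the sublevel
set a is bounded, and expanding one step gives a decrease of at least (α - α²(1 + (4R + 1)L))‖∇‖².
-/
lemma nodeQuad_gradient_step {A : ℝ} {F : E d → ℝ} {G : E d → E d} {L R α η : ℝ}
    (hG : ∀ θ, HasGradientAt F (G θ) θ) (hlip : ∀ θ θ', ‖G θ - G θ'‖ ≤ L * ‖θ - θ'‖)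
    (hbd : ∀ θ, ‖G θ‖ ≤ L) (hF : ∀ θ, |F θ| ≤ R) (hα : 0 < α) (hη : 0 < η)
    (hstep : α * (1 + (4 * R + 1) * L) < 1 / 2) {x : Node d} (hx : nodeQuad A F x ≤ A)
    (hg : η ≤ ‖gradient (nodeQuad A F) x‖) :
    nodeQuad A F (x - α • gradient (nodeQuad A F) x) < nodeQuad A F x - α * η ^ 2 / 2 := by
  have hL : 0 ≤ L := (norm_nonneg _).trans (hbd 0)
  rw [(hasGradientAt_nodeQuad hG x).gradient] at hg ⊢
  set a := x.fst with ha
  set θ := x.snd with hθ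
  set g := 2 * (a + F θ) with hgdef
  set u := (2 * a) • G θ with hu
  have hnorm : ‖nodeQuadGrad F G x‖ ^ 2 = g ^ 2 + ‖u‖ ^ 2 := by
    rw [WithLp.prod_norm_sq_eq_of_L2]
    simp [nodeQuadGrad, ← ha, ← hθ, hgdef, hu, mul_pow]
  have hR : 0 ≤ R := (abs_nonneg _).trans (hF 0)
  -- The sublevel condition reads a(a + 2F) ≤ 0, so a lies between 0 and -2F.
  have haR : |a| ≤ 2 * R := by
    have h1 : a * (a + 2 * F θ) ≤ 0 := by
      have : A + 2 * a * F θ + a ^ 2 ≤ A := hx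
      linarith
    have h2 := abs_le.1 (hF θ)
    rw [abs_le]
    constructor <;> by_contra h <;> push Not at h <;> nlinarith
  have hfst : (x - α • nodeQuadGrad F G x).fst = a - α * g := by
    simp [nodeQuadGrad, hgdef, ha, hθ]
  have hsnd : (x - α • nodeQuadGrad F G x).snd = θ - α • u := by
    simp [nodeQuadGrad, hu, ha, hθ]
  have h1 := abs_sub_inner_le_of_lipschitz_gradient hG hlip hL θ (θ - α • u)
  have h2 := abs_sub_le_of_gradient_le hG hbd θ (θ - α • u)
  have hdiff : θ - α • u - θ = -(α • u) := by abel
  rw [hdiff, norm_neg, norm_smul, Real.norm_of_nonneg hα.le] at h1 h2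
  have hin : 2 * a * inner ℝ (G θ) (-(α • u)) = -(α * ‖u‖ ^ 2) := by
    rw [inner_neg_right, inner_smul_right, ← real_inner_self_eq_norm_sq u]
    nth_rw 2 [hu]
    rw [inner_smul_left]
    simp
    ring
  set D := F (θ - α • u) - F θ with hD
  -- The change of F through θ to second order; `e2` bounds the mixed term between the changes of a
  -- and θ.
  have e1 : 2 * a * D ≤ -(α * ‖u‖ ^ 2) + 4 * R * L * (α ^ 2 * ‖u‖ ^ 2) := by
    have : 2 * a * (D - inner ℝ (G θ) (-(α • u))) ≤ 2 * (2 * R) * (L * (α * ‖u‖) ^ 2) :=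
      calc _ ≤ |2 * a * (D - inner ℝ (G θ) (-(α • u)))| := le_abs_self _
        _ = 2 * |a| * |D - inner ℝ (G θ) (-(α • u))| := by rw [abs_mul, abs_mul, abs_two]
        _ ≤ _ := by gcongr
    rw [mul_sub, hin] at this
    nlinarith
  have e2 : 2 * (-(α * g)) * D ≤ L * (α ^ 2 * (g ^ 2 + ‖u‖ ^ 2)) :=
    calc _ ≤ |2 * (-(α * g)) * D| := le_abs_self _
      _ = 2 * (α * |g|) * |D| := by rw [abs_mul, abs_mul, abs_two, abs_neg, abs_mul, abs_of_pos hα]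
      _ ≤ 2 * (α * |g|) * (L * (α * ‖u‖)) := by gcongr
      _ = L * α ^ 2 * (2 * |g| * ‖u‖) := by ring
      _ ≤ L * α ^ 2 * (g ^ 2 + ‖u‖ ^ 2) := by
        gcongr
        rw [← sq_abs g]
        nlinarith [sq_nonneg (|g| - ‖u‖)]
      _ = _ := by ring
  have hval : nodeQuad A F (x - α • nodeQuadGrad F G x) - nodeQuad A F x =
      2 * a * D + 2 * (-(α * g)) * D + (-(α * g ^ 2) + α ^ 2 * g ^ 2) := by
    unfold nodeQuad
    rw [hfst, hsnd, ← ha, ← hθ, hD, hgdef]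
    ring
  have hgu : η ^ 2 ≤ g ^ 2 + ‖u‖ ^ 2 := by
    rw [← hnorm]; gcongr
  have hpos : 0 < g ^ 2 + ‖u‖ ^ 2 := (by positivity : 0 < η ^ 2).trans_le hgu
  have hα2 : α ^ 2 * (1 + (4 * R + 1) * L) * (g ^ 2 + ‖u‖ ^ 2) <
      α * (1 / 2) * (g ^ 2 + ‖u‖ ^ 2) := by
    refine mul_lt_mul_of_pos_right ?_ hpos
    rw [sq, mul_assoc]
    exact mul_lt_mul_of_pos_left hstep hα
  have hx1 : 0 ≤ α ^ 2 * ‖u‖ ^ 2 := by positivity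
  have hx2 : 0 ≤ 4 * R * L * (α ^ 2 * g ^ 2) := by positivity
  have hx3 : α * η ^ 2 ≤ α * (g ^ 2 + ‖u‖ ^ 2) := by gcongr
  nlinarith

end

/-! ### The field near a target node -/

section

variable {d k : ℕ}

/-- The first `n` nodes have been matched, up to an error `e`, with the target nodes that the
injection `π` assigns to them, and the other nodes are absent. -/
structure Matched (w : Fin k → E d) (b : Fin k → ℝ) (e : ℝ) (n : ℕ) (p : Params d k)
    (π : Fin k → Fin k) : Prop where
  injOn : InjOn π {i | (i : ℕ) < n}
  weight : ∀ i : Fin k, (i : ℕ) < n → |p.1 i + b (π i)| ≤ e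
  center : ∀ i : Fin k, (i : ℕ) < n → ‖p.2 i - w (π i)‖ ≤ e
  absent : ∀ i : Fin k, n ≤ i → p.1 i = 0

variable {w : Fin k → E d} {b : Fin k → ℝ} {e r : ℝ} {n : ℕ} {p : Params d k}
  {π : Fin k → Fin k} {V : Type*} [AddCommGroup V] [Module ℝ V] {ψ : E d → V}

lemma Matched.sum_eq_zero (h : Matched w b e n p π) (hψ : ∀ u, r ≤ ‖u‖ → ψ u = 0)
    {θ : E d} {s : Finset (Fin k)}
    (hs : ∀ i ∈ s, (i : ℕ) < n → r + e ≤ ‖θ - w (π i)‖) :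
    ∑ i ∈ s, p.1 i • ψ (θ - p.2 i) = 0 := by
  refine Finset.sum_eq_zero fun i hi => ?_
  rcases lt_or_ge (i : ℕ) n with hin | hin
  · rw [hψ, smul_zero]
    have h1 := h.center i hin
    have h2 := norm_add_le (θ - p.2 i) (p.2 i - w (π i))
    rw [sub_add_sub_cancel] at h2
    linarith [hs i hi hin]
  · rw [h.absent i hin, zero_smul]

/-- A kernel centred within e of a target reaches at most r + e from it. Separation 3r makes these
neighbourhoods disjoint up to boundary, as 3r - (r + e) ≥ r + e. -/
lemma norm_sub_le_of_separated (hsep : ∀ i j, i ≠ j → 3 * r ≤ ‖w i - w j‖) (he : 2 * e ≤ r)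
    {θ : E d} {i j : Fin k} (hij : i ≠ j) (hθ : ‖θ - w j‖ ≤ r + e) : r + e ≤ ‖θ - w i‖ := by
  have h1 := hsep i j hij
  have h2 := norm_sub_le (θ - w j) (θ - w i)
  rw [sub_sub_sub_cancel_left] at h2
  linarith

lemma sum_target_eq (hsep : ∀ i j, i ≠ j → 3 * r ≤ ‖w i - w j‖) (he0 : 0 ≤ e) (he : 2 * e ≤ r)
    (hψ : ∀ u, r ≤ ‖u‖ → ψ u = 0) {θ : E d} {j : Fin k} (hθ : ‖θ - w j‖ ≤ r + e) :
    ∑ i, b i • ψ (θ - w i) = b j • ψ (θ - w j) := by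
  refine Finset.sum_eq_single_of_mem j (Finset.mem_univ j) fun i _ hij => ?_
  rw [hψ, smul_zero]
  linarith [norm_sub_le_of_separated hsep he hij hθ]

/-- Values in a general module let this serve both the kernel and its gradient field. -/
lemma Matched.field_eq_of_unmatched (h : Matched w b e n p π)
    (hsep : ∀ i j, i ≠ j → 3 * r ≤ ‖w i - w j‖) (he0 : 0 ≤ e) (he : 2 * e ≤ r)
    (hψ : ∀ u, r ≤ ‖u‖ → ψ u = 0) {θ : E d} {j : Fin k} (hθ : ‖θ - w j‖ ≤ r + e)
    (hj : ∀ i : Fin k, (i : ℕ) < n → π i ≠ j) :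
    field ψ w b p θ = b j • ψ (θ - w j) := by
  rw [field, sum_target_eq hsep he0 he hψ hθ, h.sum_eq_zero hψ, zero_add]
  exact fun i _ hin => norm_sub_le_of_separated hsep he (hj i hin) hθ

lemma Matched.field_eq_of_matched (h : Matched w b e n p π)
    (hsep : ∀ i j, i ≠ j → 3 * r ≤ ‖w i - w j‖) (he0 : 0 ≤ e) (he : 2 * e ≤ r)
    (hψ : ∀ u, r ≤ ‖u‖ → ψ u = 0) {θ : E d} {i : Fin k} (hi : (i : ℕ) < n)
    (hθ : ‖θ - w (π i)‖ ≤ r + e) :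
    field ψ w b p θ = p.1 i • ψ (θ - p.2 i) + b (π i) • ψ (θ - w (π i)) := by
  rw [field, sum_target_eq hsep he0 he hψ hθ, ← Finset.add_sum_erase _ _ (Finset.mem_univ i),
    h.sum_eq_zero hψ, add_zero]
  refine fun i' hi' hin => norm_sub_le_of_separated hsep he (fun heq => ?_) hθ
  exact Finset.ne_of_mem_erase hi' (h.injOn hin hi heq)

lemma Matched.exists_near_of_field_ne_zero (h : Matched w b e n p π) (he0 : 0 ≤ e)
    (hψ : ∀ u, r ≤ ‖u‖ → ψ u = 0) {θ : E d} (hθ : field ψ w b p θ ≠ 0) :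
    ∃ j, ‖θ - w j‖ ≤ r + e := by
  by_contra! hcon
  refine hθ ?_
  rw [field, h.sum_eq_zero hψ fun i _ _ => (hcon (π i)).le, zero_add]
  exact Finset.sum_eq_zero fun j _ => by rw [hψ _ (by linarith [hcon j]), smul_zero]

lemma Matched.abs_weight_le (h : Matched w b e n p π) (he : e ≤ 1) (hb : ∀ j, |b j| ≤ 1)
    (i : Fin k) : |p.1 i| ≤ 2 := by
  rcases lt_or_ge (i : ℕ) n with hin | hin
  · have h1 := h.weight i hin
    have h2 := abs_sub (p.1 i + b (π i)) (b (π i))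
    rw [add_sub_cancel_right] at h2
    linarith [hb (π i)]
  · rw [h.absent i hin]; simp

lemma norm_field_le {W : Type*} [NormedAddCommGroup W] [NormedSpace ℝ W] {χ : E d → W} {B : ℝ}
    (hχ : ∀ u, ‖χ u‖ ≤ B) (hp : ∀ i, |p.1 i| ≤ 2) (hb : ∀ j, |b j| ≤ 1) (θ : E d) :
    ‖field χ w b p θ‖ ≤ 3 * k * B := by
  have h1 : ‖∑ i, p.1 i • χ (θ - p.2 i)‖ ≤ ∑ _i : Fin k, 2 * B :=
    norm_sum_le_of_le _ fun i _ => by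
      rw [norm_smul]; exact mul_le_mul (hp i) (hχ _) (norm_nonneg _) zero_le_two
  have h2 : ‖∑ j, b j • χ (θ - w j)‖ ≤ ∑ _j : Fin k, 1 * B :=
    norm_sum_le_of_le _ fun j _ => by
      rw [norm_smul]; exact mul_le_mul (hb j) (hχ _) (norm_nonneg _) zero_le_one
  simp only [Finset.sum_const, Finset.card_univ, Fintype.card_fin, nsmul_eq_mul] at h1 h2
  refine (norm_add_le _ _).trans ((add_le_add h1 h2).trans (le_of_eq (by ring)))

lemma norm_field_sub_le {W : Type*} [NormedAddCommGroup W] [NormedSpace ℝ W] {χ : E d → W} {B : ℝ}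
    (hχ : ∀ u v, ‖χ u - χ v‖ ≤ B * ‖u - v‖) (hp : ∀ i, |p.1 i| ≤ 2) (hb : ∀ j, |b j| ≤ 1)
    (θ θ' : E d) : ‖field χ w b p θ - field χ w b p θ'‖ ≤ 3 * k * B * ‖θ - θ'‖ := by
  have hχ' : ∀ z, ‖χ (θ - z) - χ (θ' - z)‖ ≤ B * ‖θ - θ'‖ := fun z => by
    simpa using hχ (θ - z) (θ' - z)
  have h1 : ‖∑ i, p.1 i • (χ (θ - p.2 i) - χ (θ' - p.2 i))‖ ≤ ∑ _i : Fin k, 2 * (B * ‖θ - θ'‖) :=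
    norm_sum_le_of_le _ fun i _ => by
      rw [norm_smul]; exact mul_le_mul (hp i) (hχ' _) (norm_nonneg _) zero_le_two
  have h2 : ‖∑ j, b j • (χ (θ - w j) - χ (θ' - w j))‖ ≤ ∑ _j : Fin k, 1 * (B * ‖θ - θ'‖) :=
    norm_sum_le_of_le _ fun j _ => by
      rw [norm_smul]; exact mul_le_mul (hb j) (hχ' _) (norm_nonneg _) zero_le_one
  simp only [Finset.sum_const, Finset.card_univ, Fintype.card_fin, nsmul_eq_mul] at h1 h2
  have : field χ w b p θ - field χ w b p θ' =
      ∑ i, p.1 i • (χ (θ - p.2 i) - χ (θ' - p.2 i)) + ∑ j, b j • (χ (θ - w j) - χ (θ' - w j)) := by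
    simp only [field, smul_sub, Finset.sum_sub_distrib]
    abel
  rw [this]
  refine (norm_add_le _ _).trans ((add_le_add h1 h2).trans (le_of_eq (by ring)))

variable {φ : E d → ℝ} {G : E d → E d} {M c κ : ℝ}

lemma hasGradientAt_field (hG : ∀ u, HasGradientAt φ (G u) u) (θ : E d) :
    HasGradientAt (field φ w b p) (field G w b p θ) θ := by
  rw [hasGradientAt_iff_hasFDerivAt]
  have hsub : ∀ z, HasFDerivAt (fun θ => φ (θ - z))
      (InnerProductSpace.toDual ℝ (E d) (G (θ - z))) θ := fun z => by
    have h1 : HasFDerivAt (fun θ : E d => θ - z) (ContinuousLinearMap.id ℝ (E d)) θ :=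
      (hasFDerivAt_id θ).sub_const z
    exact (hG (θ - z)).hasFDerivAt.comp θ h1
  have h := (HasFDerivAt.fun_sum fun i (_ : i ∈ Finset.univ) =>
      (hsub (p.2 i)).const_smul (p.1 i)).add
    (HasFDerivAt.fun_sum fun j (_ : j ∈ Finset.univ) => (hsub (w j)).const_smul (b j))
  convert! h using 1
  simp [field, map_add, map_sum]

/-- Where φ vanishes it attains its minimum; this includes the boundary ‖u‖ = r. -/
lemma IsLocalKernel.gradient_eq_zero (h : IsLocalKernel φ G r M c κ) {u : E d} (hu : r ≤ ‖u‖) :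
    G u = 0 := by
  have hmin : IsLocalMin φ u :=
    Filter.Eventually.of_forall fun x => by rw [h.support u hu]; exact h.nonneg x
  have := hmin.hasFDerivAt_eq_zero (h.hasGradientAt u).hasFDerivAt
  simpa using this

end

/-! ### Node-wise descent with a local kernel -/

/-- The target nodes are separated and their output weights are neither too large nor too small. -/
structure IsGoodTarget {d k : ℕ} (w : Fin k → E d) (b : Fin k → ℝ) (r β : ℝ) : Prop where
  separated : ∀ i j, i ≠ j → 3 * r ≤ ‖w i - w j‖
  le_one : ∀ j, |b j| ≤ 1
  le_abs : ∀ j, β ≤ |b j|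

/-- Compatibility conditions on the parameters of node-wise descent. -/
structure IsGoodParams (k : ℕ) (r M c κ β δ e α η γ : ℝ) (T : ℕ) : Prop where
  e_pos : 0 < e
  e_le : 2 * e ≤ r
  e_le_one : e ≤ 1
  δ_pos : 0 < δ
  α_pos : 0 < α
  η_pos : 0 < η
  γ_pos : 0 < γ
  c_pos : 0 < c
  κ_pos : 0 < κ
  β_pos : 0 < β
  one_le_M : 1 ≤ M
  residual : (M + 1) * e < δ
  η_le : η ≤ δ
  precision : η + M * (η / (c * δ ^ 2)) ≤ e
  step : α * (1 + (4 * (3 * k) + 1) * (3 * k * M)) < 1 / 2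
  steps : 16 * (k : ℝ) ^ 2 < T * min (α * η ^ 2 / 2) (α ^ 2 * γ ^ 3 / 2)
  margin : 8 * k * δ ≤ (β * κ) ^ 2

section

variable {d k : ℕ} {σ : E d → E d → ℝ} {φ : E d → ℝ} {G : E d → E d} {w : Fin k → E d}
  {b : Fin k → ℝ} {r M c κ β δ e α η γ : ℝ} {T n : ℕ} {p : Params d k} {π : Fin k → Fin k}

/-- An approximate critical point at which the field is not small is close to an unmatched target
node, with nearly the right output weight. -/
lemma Matched.exists_close (hker : IsLocalKernel φ G r M c κ) (ht : IsGoodTarget w b r β)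
    (hP : IsGoodParams k r M c κ β δ e α η γ T) (hm : Matched w b e n p π) {x : Node d}
    (hF : δ ≤ |field φ w b p x.snd|)
    (hg : ‖nodeQuadGrad (field φ w b p) (field G w b p) x‖ < η) :
    ∃ j, (∀ i : Fin k, (i : ℕ) < n → π i ≠ j) ∧ |x.fst + b j| ≤ e ∧ ‖x.snd - w j‖ ≤ e := by
  have he0 := hP.e_pos.le
  have hδ := hP.δ_pos
  have hM := hP.one_le_M
  have hc := hP.c_pos
  have hφlip : ∀ u u', |φ u' - φ u| ≤ M * ‖u' - u‖ := fun u u' =>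
    abs_sub_le_of_gradient_le hker.hasGradientAt hker.norm_le u u'
  set a := x.fst with ha
  set θ := x.snd with hθ
  have hF0 : field φ w b p θ ≠ 0 := fun h => by rw [h, abs_zero] at hF; linarith
  obtain ⟨j, hj⟩ := hm.exists_near_of_field_ne_zero he0 hker.support hF0
  -- Near a matched target the learned and target terms cancel up to (M + 1)e, which is less than δ.
  have hnew : ∀ i : Fin k, (i : ℕ) < n → π i ≠ j := by
    rintro i hi rfl
    rw [hm.field_eq_of_matched ht.separated he0 hP.e_le hker.support hi hj] at hF
    simp only [smul_eq_mul] at hF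
    have h1 : p.1 i * φ (θ - p.2 i) + b (π i) * φ (θ - w (π i)) =
        (p.1 i + b (π i)) * φ (θ - p.2 i) +
          b (π i) * (φ (θ - w (π i)) - φ (θ - p.2 i)) := by ring
    have h2 : |(p.1 i + b (π i)) * φ (θ - p.2 i)| ≤ e * 1 := by
      rw [abs_mul, abs_of_nonneg (hker.nonneg _)]
      exact mul_le_mul (hm.weight i hi) (hker.le_one _) (hker.nonneg _) he0
    have h3 : |b (π i) * (φ (θ - w (π i)) - φ (θ - p.2 i))| ≤ 1 * (M * e) := by
      rw [abs_mul]
      refine mul_le_mul (ht.le_one _) ((hφlip _ _).trans ?_) (abs_nonneg _) zero_le_one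
      rw [sub_sub_sub_cancel_left]
      exact mul_le_mul_of_nonneg_left (hm.center i hi) (by linarith)
    rw [h1] at hF
    linarith [abs_add_le ((p.1 i + b (π i)) * φ (θ - p.2 i))
      (b (π i) * (φ (θ - w (π i)) - φ (θ - p.2 i))), hP.residual]
  refine ⟨j, hnew, ?_⟩
  have hFj := hm.field_eq_of_unmatched ht.separated he0 hP.e_le hker.support hj hnew
  have hGj := hm.field_eq_of_unmatched ht.separated he0 hP.e_le
    (fun u hu => hker.gradient_eq_zero hu) hj hnew
  rw [smul_eq_mul] at hFj
  have hnorm : ‖nodeQuadGrad (field φ w b p) (field G w b p) x‖ ^ 2 =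
      (2 * (a + field φ w b p θ)) ^ 2 + ‖(2 * a) • field G w b p θ‖ ^ 2 := by
    rw [WithLp.prod_norm_sq_eq_of_L2]
    simp [nodeQuadGrad, ← ha, ← hθ, mul_pow]
  have hg2 : ‖nodeQuadGrad (field φ w b p) (field G w b p) x‖ ^ 2 < η ^ 2 := by gcongr
  rw [hnorm] at hg2
  have hgw : |2 * (a + field φ w b p θ)| < η :=
    abs_lt_of_sq_lt_sq (by nlinarith [sq_nonneg ‖(2 * a) • field G w b p θ‖]) hP.η_pos.le
  have hgθ : ‖(2 * a) • field G w b p θ‖ < η := by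
    rw [← abs_of_nonneg (norm_nonneg ((2 * a) • field G w b p θ))]
    exact abs_lt_of_sq_lt_sq (by nlinarith [sq_nonneg (2 * (a + field φ w b p θ))]) hP.η_pos.le
  rw [abs_mul, abs_two] at hgw
  rw [norm_smul, Real.norm_eq_abs, abs_mul, abs_two] at hgθ
  -- The first gradient component gives |a + F| < η/2 ≤ δ/2, while |F| ≥ δ. So a is not small, and
  -- the second component controls ∇F itself.
  have haδ : δ ≤ 2 * |a| := by
    have := abs_sub (a + field φ w b p θ) a
    rw [add_sub_cancel_left] at this
    linarith [hP.η_le]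
  set u := θ - w j with hu
  have hGη : δ * ‖field G w b p θ‖ < η :=
    (mul_le_mul_of_nonneg_right haδ (norm_nonneg _)).trans_lt hgθ
  -- The drift inequality with Cauchy–Schwarz; dividing by ‖u‖ bounds the distance to the target by
  -- the gradient of the field.
  have hdrift : c * ‖u‖ ^ 2 * |field φ w b p θ| ≤ ‖field G w b p θ‖ * ‖u‖ := by
    have h1 := hker.drift u
    have h2 : c * ‖u‖ ^ 2 * φ u ≤ |inner ℝ (G u) u| := by
      have := neg_le_abs (inner ℝ (G u) u); linarith
    have h3 : |inner ℝ (field G w b p θ) u| = |b j| * |inner ℝ (G u) u| := by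
      rw [hGj, real_inner_smul_left, abs_mul]
    rw [hFj, abs_mul, abs_of_nonneg (hker.nonneg u)]
    calc c * ‖u‖ ^ 2 * (|b j| * φ u) = |b j| * (c * ‖u‖ ^ 2 * φ u) := by ring
      _ ≤ |b j| * |inner ℝ (G u) u| := by gcongr
      _ = |inner ℝ (field G w b p θ) u| := h3.symm
      _ ≤ _ := abs_real_inner_le_norm _ _
  have hu_le : ‖u‖ ≤ η / (c * δ ^ 2) := by
    rcases (norm_nonneg u).eq_or_lt with h0 | h0
    · rw [← h0]; have := hP.η_pos; positivity
    · rw [le_div_iff₀ (by positivity)]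
      have h1 : c * ‖u‖ * |field φ w b p θ| ≤ ‖field G w b p θ‖ := by
        refine le_of_mul_le_mul_right ?_ h0
        linarith
      have h2 : c * ‖u‖ * δ ≤ ‖field G w b p θ‖ :=
        (mul_le_mul_of_nonneg_left hF (by positivity)).trans h1
      calc ‖u‖ * (c * δ ^ 2) = δ * (c * ‖u‖ * δ) := by ring
        _ ≤ δ * ‖field G w b p θ‖ := by gcongr
        _ ≤ η := hGη.le
  have hq0 : 0 ≤ η / (c * δ ^ 2) := (norm_nonneg _).trans hu_le
  constructor
  · have h1 : |1 - φ u| ≤ M * ‖u‖ := by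
      have := hφlip u 0
      rwa [hker.map_zero, zero_sub, norm_neg] at this
    -- The weight error splits into the residual a + F and the drop of φ from its value 1 at the
    -- centre.
    have h2 : a + b j = (a + field φ w b p θ) + b j * (1 - φ u) := by rw [hFj]; ring
    have h3 : |b j * (1 - φ u)| ≤ 1 * (M * (η / (c * δ ^ 2))) := by
      rw [abs_mul]
      exact mul_le_mul (ht.le_one j) (h1.trans (by gcongr)) (abs_nonneg _) zero_le_one
    rw [h2]
    linarith [abs_add_le (a + field φ w b p θ) (b j * (1 - φ u)), hP.precision, hP.η_pos,
      abs_nonneg (a + field φ w b p θ)]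
  · have := hP.precision
    nlinarith [hP.η_pos]

lemma Matched.setNode (hn : n < k) (hm : Matched w b e n p π) {x : Node d} {j : Fin k}
    (hj : ∀ i : Fin k, (i : ℕ) < n → π i ≠ j) (ha : |x.fst + b j| ≤ e)
    (hθ : ‖x.snd - w j‖ ≤ e) :
    Matched w b e (n + 1) (setNode p ⟨n, hn⟩ x) (Function.update π ⟨n, hn⟩ j) := by
  have hcase : ∀ i : Fin k, (i : ℕ) < n + 1 → i = ⟨n, hn⟩ ∨ (i : ℕ) < n ∧ i ≠ ⟨n, hn⟩ := by
    intro i hi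
    rcases eq_or_ne i ⟨n, hn⟩ with h | h
    · exact Or.inl h
    · have : (i : ℕ) ≠ n := fun h' => h (Fin.ext h')
      exact Or.inr ⟨by omega, h⟩
  refine ⟨fun i hi i' hi' heq => ?_, fun i hi => ?_, fun i hi => ?_, fun i hi => ?_⟩
  · rcases hcase i hi with rfl | ⟨h1, h2⟩ <;> rcases hcase i' hi' with rfl | ⟨h3, h4⟩
    · rfl
    · rw [Function.update_self, Function.update_of_ne h4] at heq
      exact absurd heq.symm (hj i' h3)
    · rw [Function.update_self, Function.update_of_ne h2] at heq
      exact absurd heq (hj i h1)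
    · rw [Function.update_of_ne h2, Function.update_of_ne h4] at heq
      exact hm.injOn h1 h3 heq
  · rcases hcase i hi with rfl | ⟨h1, h2⟩
    · simpa [NodeWise.setNode] using ha
    · simpa [NodeWise.setNode, h2] using hm.weight i h1
  · rcases hcase i hi with rfl | ⟨h1, h2⟩
    · simpa [NodeWise.setNode] using hθ
    · simpa [NodeWise.setNode, h2] using hm.center i h1
  · have h2 : i ≠ ⟨n, hn⟩ := by rintro rfl; simp at hi
    simpa [NodeWise.setNode, h2] using hm.absent i (by omega)

lemma exists_forall_lt_ne (π : Fin k → Fin k) (hn : n < k) :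
    ∃ j, ∀ i : Fin k, (i : ℕ) < n → π i ≠ j := by
  by_contra! h
  choose f hf hπ using h
  have hinj : Function.Injective f := fun j j' hjj => by rw [← hπ j, ← hπ j', hjj]
  obtain ⟨j, hj⟩ := Finite.surjective_of_injective hinj ⟨n, hn⟩
  have := hf j
  rw [hj] at this
  exact lt_irrefl _ this

lemma Matched.nodeObjective_eq
    (hσ : ∀ w, MemLp (fun x => σ x w) 2 (stdGaussian (E d)))
    (hφ : ∀ θ w, potential σ θ w = φ (θ - w)) (hker : IsLocalKernel φ G r M c κ)
    (hm : Matched w b e n p π) {i : Fin k} (hi : n ≤ i) :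
    nodeObjective (loss σ w b) p i = nodeQuad (loss σ w b p) (field φ w b p) := by
  ext x
  exact loss_setNode hσ hφ hker.map_zero (hm.absent i hi) x

lemma Matched.sqrt_loss_le
    (hσ : ∀ w, MemLp (fun x => σ x w) 2 (stdGaussian (E d)))
    (hφ : ∀ θ w, potential σ θ w = φ (θ - w)) (hker : IsLocalKernel φ G r M c κ)
    (ht : IsGoodTarget w b r β) (hP : IsGoodParams k r M c κ β δ e α η γ T)
    (hm : Matched w b e n p π) : √(loss σ w b p) ≤ 4 * k := by
  rw [Real.sqrt_le_left (by positivity)]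
  refine (loss_le hσ hφ hker.map_zero (hm.abs_weight_le hP.e_le_one ht.le_one)
    ht.le_one).trans (le_of_eq (by ring))

/-- One stage of node-wise descent matches one more target node. -/
lemma Matched.stage
    (hσ : ∀ w, MemLp (fun x => σ x w) 2 (stdGaussian (E d)))
    (hφ : ∀ θ w, potential σ θ w = φ (θ - w)) (hker : IsLocalKernel φ G r M c κ)
    (ht : IsGoodTarget w b r β) (hP : IsGoodParams k r M c κ β δ e α η γ T)
    (hm : Matched w b e n p π) (hn : n < k)
    (v : (Node d →L[ℝ] Node d) → Node d) {x₀ : Node d}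
    (hx₀ : GoodInit (nodeObjective (loss σ w b) p ⟨n, hn⟩) δ x₀) :
    ∃ π', Matched w b e (n + 1)
      (NodeWise.setNode p ⟨n, hn⟩
        (secondGD (nodeObjective (loss σ w b) p ⟨n, hn⟩) v x₀ T α η γ)) π' := by
  have hp := hm.abs_weight_le hP.e_le_one ht.le_one
  rw [hm.nodeObjective_eq hσ hφ hker (i := ⟨n, hn⟩) le_rfl] at hx₀ ⊢
  set A := loss σ w b p with hA
  set F := field φ w b p with hF
  have hA0 : 0 ≤ A := loss_nonneg p
  have hδ := hP.δ_pos
  have hnn : ∀ x, 0 ≤ nodeQuad A F x := fun x => by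
    rw [hA, hF, ← hm.nodeObjective_eq hσ hφ hker (i := ⟨n, hn⟩) le_rfl]
    exact loss_nonneg _
  rw [GoodInit, nodeQuad_zero] at hx₀
  have hx₀A : nodeQuad A F x₀ ≤ A := by
    rw [← Real.sqrt_le_sqrt_iff hA0]; linarith
  have hA16 : A ≤ 16 * (k : ℝ) ^ 2 := loss_le hσ hφ hker.map_zero hp ht.le_one
  have hgrad : ∀ θ, HasGradientAt F (field G w b p θ) θ := hasGradientAt_field hker.hasGradientAt
  have hFle : ∀ θ, |F θ| ≤ 3 * k := fun θ => by
    have := norm_field_le (χ := φ) (B := 1) (w := w) (p := p)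
      (fun u => by rw [Real.norm_of_nonneg (hker.nonneg u)]; exact hker.le_one u)
      hp ht.le_one θ
    rwa [mul_one] at this
  have hmin : 0 ≤ min (α * η ^ 2 / 2) (α ^ 2 * γ ^ 3 / 2) := by
    have := hP.α_pos; have := hP.η_pos; have := hP.γ_pos
    positivity
  obtain ⟨h1, h2⟩ := secondGD_spec (v := v) (γ := γ) (B := A) hnn hmin
    (fun x hx hg => nodeQuad_gradient_step hgrad
      (norm_field_sub_le hker.lipschitz hp ht.le_one)
      (norm_field_le hker.norm_le hp ht.le_one) hFle hP.α_pos hP.η_pos hP.step hx hg)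
    T x₀ hx₀A (hx₀A.trans_lt (hA16.trans_lt hP.steps))
  set x := secondGD (nodeQuad A F) v x₀ T α η γ with hx
  rw [(hasGradientAt_nodeQuad hgrad x).gradient] at h2
  have hsqrt : √(nodeQuad A F x) ≤ √A - δ := (Real.sqrt_le_sqrt h1).trans hx₀
  have hδA : δ ≤ √A := by linarith [Real.sqrt_nonneg (nodeQuad A F x)]
  -- A - F² ≤ (√A - δ)² gives F² ≥ 2δ√A - δ², which is at least δ² because √A ≥ δ.
  have hFδ : δ ≤ |F x.snd| := by
    have e1 : nodeQuad A F x ≤ (√A - δ) ^ 2 := by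
      rw [← Real.sqrt_le_left (by linarith)]; exact hsqrt
    have e2 := sub_sq_le_nodeQuad A F x
    have e3 := Real.sq_sqrt hA0
    refine abs_le_of_sq_le_sq' ?_ (abs_nonneg _) |>.2
    rw [sq_abs]
    nlinarith
  obtain ⟨j, hj, hja, hjθ⟩ := hm.exists_close hker ht hP hFδ h2
  exact ⟨_, hm.setNode hn hj hja hjθ⟩

lemma exists_matched_nodewise
    (hσ : ∀ w, MemLp (fun x => σ x w) 2 (stdGaussian (E d)))
    (hφ : ∀ θ w, potential σ θ w = φ (θ - w)) (hker : IsLocalKernel φ G r M c κ)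
    (ht : IsGoodTarget w b r β) (hP : IsGoodParams k r M c κ β δ e α η γ T)
    (v : (Node d →L[ℝ] Node d) → Node d) (start : Fin k → Node d) :
    ∀ n ≤ k, GoodInits (loss σ w b) v T α η γ δ start n →
      ∃ π, Matched w b e n (nodewise (loss σ w b) v T α η γ start n) π := by
  intro n
  induction n with
  | zero =>
    intro _ _
    exact ⟨id, ⟨fun i hi => absurd hi (Nat.not_lt_zero _), fun i hi => absurd hi (Nat.not_lt_zero _),
      fun i hi => absurd hi (Nat.not_lt_zero _), fun i _ => rfl⟩⟩
  | succ n ih =>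
    intro hn hgood
    have hn' : n < k := hn
    obtain ⟨π, hm⟩ := ih hn'.le fun i hi => hgood i (hi.trans (Nat.lt_succ_self n))
    have := hm.stage hσ hφ hker ht hP hn' v (hgood ⟨n, hn'⟩ (Nat.lt_succ_self n))
    simpa only [nodewise, hn', dite_true] using this

theorem recovers_of_isGoodParams
    (hσ : ∀ w, MemLp (fun x => σ x w) 2 (stdGaussian (E d)))
    (hφ : ∀ θ w, potential σ θ w = φ (θ - w)) (hker : IsLocalKernel φ G r M c κ)
    (ht : IsGoodTarget w b r β) (hP : IsGoodParams k r M c κ β δ e α η γ T)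
    (v : (Node d →L[ℝ] Node d) → Node d) :
    Recovers σ w b v T α η γ δ (√(2 * k) * e) := by
  intro start hstart
  obtain ⟨π, hm⟩ := exists_matched_nodewise hσ hφ hker ht hP v start k le_rfl hstart
  have hinj : Function.Injective π := fun i i' h => hm.injOn i.2 i'.2 h
  refine ⟨Equiv.ofBijective π (Finite.injective_iff_bijective.1 hinj),
    isMinOn_loss_permutedTarget _, ?_⟩
  have he := hP.e_pos.le
  -- Each of the k nodes contributes at most e² for its weight and e² for its centre, whence
  -- √(2k)·e.
  rw [paramDist, Real.sqrt_le_left (by positivity), mul_pow, Real.sq_sqrt (by positivity)]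
  calc _ ≤ ∑ _i : Fin k, 2 * e ^ 2 := by
        refine Finset.sum_le_sum fun i _ => ?_
        have h1 := hm.weight i i.2
        have h2 := hm.center i i.2
        simp only [permutedTarget, Equiv.ofBijective_apply, sub_neg_eq_add]
        rw [← sq_abs, two_mul]
        gcongr
    _ = 2 * k * e ^ 2 := by simp; ring

/-- Every point of the ball of radius `r / 2` around an unmatched target node is a successful
sample. -/
lemma Matched.goodSample
    (hσ : ∀ w, MemLp (fun x => σ x w) 2 (stdGaussian (E d)))
    (hφ : ∀ θ w, potential σ θ w = φ (θ - w)) (hker : IsLocalKernel φ G r M c κ)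
    (ht : IsGoodTarget w b r β) (hP : IsGoodParams k r M c κ β δ e α η γ T)
    (hm : Matched w b e n p π) {i : Fin k} (hi : n ≤ i) {j : Fin k}
    (hj : ∀ i : Fin k, (i : ℕ) < n → π i ≠ j) {θ : E d} (hr : 0 ≤ r) (hθ : ‖θ - w j‖ ≤ r / 2) :
    GoodSample (nodeObjective (loss σ w b) p i) δ θ := by
  rw [hm.nodeObjective_eq hσ hφ hker hi]
  set A := loss σ w b p with hA
  set F := field φ w b p with hF
  have hFθ : F θ = b j * φ (θ - w j) :=
    hm.field_eq_of_unmatched ht.separated hP.e_pos.le hP.e_le hker.support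
      (hθ.trans (by linarith [hP.e_pos])) hj
  have hFle : (β * κ) ^ 2 ≤ F θ ^ 2 := by
    rw [← sq_abs (F θ), hFθ, abs_mul, abs_of_nonneg (hker.nonneg _)]
    have := hP.β_pos; have := hP.κ_pos
    gcongr
    · exact ht.le_abs j
    · exact hker.lower _ hθ
  have hval : nodeQuad A F (WithLp.toLp 2 (-F θ, θ)) = A - F θ ^ 2 := by
    change A + 2 * -F θ * F θ + (-F θ) ^ 2 = _
    ring
  have hFA : F θ ^ 2 ≤ A := by
    have : 0 ≤ nodeQuad A F (WithLp.toLp 2 (-F θ, θ)) := by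
      rw [hA, hF, ← hm.nodeObjective_eq hσ hφ hker hi]
      exact loss_nonneg _
    linarith
  have hk0 := hm.sqrt_loss_le hσ hφ hker ht hP
  refine ⟨-F θ, fun a' => ?_, ?_⟩
  · rw [hval]; exact sub_sq_le_nodeQuad A F (WithLp.toLp 2 (a', θ))
  · rw [GoodInit, hval, nodeQuad_zero]
    have hδ := hP.δ_pos
    have hpos : 0 < (β * κ) ^ 2 := by have := hP.β_pos; have := hP.κ_pos; positivity
    have hs : 0 < √A := Real.sqrt_pos.2 (by linarith)
    -- Dropping δ² from (√A - δ)² shows that this suffices for admissibility. It follows from √A ≤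
    -- 4k and the margin condition.
    have h2 : 2 * δ * √A ≤ F θ ^ 2 := by
      refine le_trans ?_ (hP.margin.trans hFle)
      calc 2 * δ * √A ≤ 2 * δ * (4 * k) := by gcongr
        _ = 8 * k * δ := by ring
    have hsq := Real.sq_sqrt (show 0 ≤ A by linarith)
    have hδs : 2 * δ ≤ √A := by
      refine le_of_mul_le_mul_right ?_ hs
      nlinarith
    rw [Real.sqrt_le_left (by linarith)]
    nlinarith

/-- Before stage k some target is still unmatched, and the half-radius ball around it consists of
successful samples. -/
theorem initSucceeds_of_isGoodParams
    (hσ : ∀ w, MemLp (fun x => σ x w) 2 (stdGaussian (E d)))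
    (hφ : ∀ θ w, potential σ θ w = φ (θ - w)) (hker : IsLocalKernel φ G r M c κ)
    (ht : IsGoodTarget w b r β) (hP : IsGoodParams k r M c κ β δ e α η γ T)
    (v : (Node d →L[ℝ] Node d) → Node d) {R ρ : ℝ} (hr : 0 ≤ r)
    (hvol : ∀ j, ENNReal.ofReal ρ ≤ uniformBall d R (Metric.closedBall (w j) (r / 2))) :
    InitSucceeds (loss σ w b) v T α η γ δ R ρ := by
  intro start i hstart
  obtain ⟨π, hm⟩ := exists_matched_nodewise hσ hφ hker ht hP v start i i.2.le hstart
  obtain ⟨j, hj⟩ := exists_forall_lt_ne π i.2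
  refine (hvol j).trans (measure_mono fun θ hθ => ?_)
  exact hm.goodSample hσ hφ hker ht hP le_rfl hj hr (mem_closedBall_iff_norm.1 hθ)

end

/-! ### Gaussian estimates -/

section

variable {d k : ℕ}

lemma lintegral_exp_neg_mul_sq_norm_sub {b : ℝ} (hb : 0 < b) (z : E d) :
    ∫⁻ x : E d, ENNReal.ofReal (Real.exp (-b * ‖x - z‖ ^ 2)) =
      ENNReal.ofReal ((Real.pi / b) ^ (d / 2 : ℝ)) := by
  rw [lintegral_sub_right_eq_self (fun x : E d => ENNReal.ofReal (Real.exp (-b * ‖x‖ ^ 2))) z,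
    ← ofReal_integral_eq_lintegral_ofReal (integrable_exp_neg_mul_sq_norm hb)
      (Filter.Eventually.of_forall fun _ => (Real.exp_pos _).le),
    GaussianFourier.integral_rexp_neg_mul_sq_norm hb, finrank_euclideanSpace_fin]

/-- A Chernoff-type comparison with an unnormalised Gaussian of another width and centre; it yields
both the small-ball and the tail bound. -/
lemma stdGaussian_le_of_density_le {S : Set (E d)} {a b : ℝ} (ha : 0 ≤ a) (hb : 0 < b) (z : E d)
    (h : ∀ x ∈ S, Real.exp (-(1 / 2) * ‖x‖ ^ 2) ≤ a * Real.exp (-b * ‖x - z‖ ^ 2)) :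
    stdGaussian (E d) S ≤ ENNReal.ofReal (a * (2 * b) ^ (-(d / 2 : ℝ))) := by
  rw [stdGaussian_eq_withDensity, withDensity_apply' _ S]
  have hπ := Real.pi_pos
  set q : ℝ := (2 * Real.pi) ^ (-(d / 2 : ℝ)) with hq
  have hq0 : 0 < q := by positivity
  calc ∫⁻ x in S, ENNReal.ofReal (gaussDensity x)
      ≤ ∫⁻ x in S, ENNReal.ofReal (q * a) * ENNReal.ofReal (Real.exp (-b * ‖x - z‖ ^ 2)) := by
        refine setLIntegral_mono (by fun_prop) fun x hx => ?_
        rw [← ENNReal.ofReal_mul (by positivity), mul_assoc]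
        exact ENNReal.ofReal_le_ofReal (mul_le_mul_of_nonneg_left (h x hx) hq0.le)
    _ ≤ ∫⁻ x, ENNReal.ofReal (q * a) * ENNReal.ofReal (Real.exp (-b * ‖x - z‖ ^ 2)) :=
        setLIntegral_le_lintegral _ _
    _ = ENNReal.ofReal (a * (2 * b) ^ (-(d / 2 : ℝ))) := by
        rw [lintegral_const_mul _ (by fun_prop), lintegral_exp_neg_mul_sq_norm_sub hb,
          ← ENNReal.ofReal_mul (by positivity)]
        congr 1
        have h2 : 2 * b = (2 * Real.pi) * (Real.pi / b)⁻¹ := by field_simp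
        rw [h2, Real.mul_rpow (by positivity) (by positivity), Real.inv_rpow (by positivity),
          Real.rpow_neg (by positivity) (y := (d / 2 : ℝ)) (x := Real.pi / b), inv_inv, hq]
        ring

lemma stdGaussian_closedBall_le {l : ℝ} (hl : 0 < l) (z : E d) (t : ℝ) :
    stdGaussian (E d) (Metric.closedBall z t) ≤
      ENNReal.ofReal (Real.exp (l * t ^ 2) * (2 * l) ^ (-(d / 2 : ℝ))) := by
  refine stdGaussian_le_of_density_le (Real.exp_pos _).le hl z fun x hx => ?_
  rw [mem_closedBall_iff_norm] at hx
  rw [← Real.exp_add, Real.exp_le_exp]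
  have h1 : ‖x - z‖ ^ 2 ≤ t ^ 2 := by gcongr
  nlinarith [sq_nonneg ‖x‖]

/-- Half of the exponent ‖x‖²/2 pays for the tail; the other half remains integrable, at the cost of
2^(d/2). -/
lemma stdGaussian_norm_gt_le {t : ℝ} (ht : 0 ≤ t) :
    stdGaussian (E d) {x | t < ‖x‖} ≤
      ENNReal.ofReal (Real.exp (-(t ^ 2 / 4)) * (1 / 2) ^ (-(d / 2 : ℝ))) := by
  have := stdGaussian_le_of_density_le (S := {x : E d | t < ‖x‖})
    (Real.exp_pos (-(t ^ 2 / 4))).le (b := 1 / 4) (by norm_num) 0 fun x hx => ?_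
  · refine this.trans (le_of_eq ?_)
    norm_num
  · have hx' : t < ‖x‖ := hx
    rw [← Real.exp_add, Real.exp_le_exp, sub_zero]
    nlinarith

lemma multivariateGaussian_smul_one {s : ℝ} (hs : 0 ≤ s) :
    multivariateGaussian (0 : E d) (s • (1 : Matrix (Fin d) (Fin d) ℝ)) =
      (stdGaussian (E d)).map fun x => √s • x := by
  have hps : (s • (1 : Matrix (Fin d) (Fin d) ℝ)).PosSemidef := Matrix.PosSemidef.one.smul hs
  refine Measure.ext_of_charFun ?_
  ext t
  rw [charFun_multivariateGaussian hps, charFun_map_smul, charFun_stdGaussian]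
  rw [inner_zero_right, norm_smul, Real.norm_of_nonneg (Real.sqrt_nonneg s)]
  congr 1
  have h1 : (WithLp.ofLp t) ⬝ᵥ Matrix.mulVec (s • (1 : Matrix (Fin d) (Fin d) ℝ)) t = s * ‖t‖ ^ 2 := by
    rw [Matrix.smul_mulVec, Matrix.one_mulVec, dotProduct_smul, EuclideanSpace.real_norm_sq_eq]
    simp [dotProduct, sq]
  have h2 : (√s) ^ 2 = s := Real.sq_sqrt hs
  rw [h1]
  push_cast
  rw [mul_pow, ← Complex.ofReal_pow (√s), h2, zero_mul, zero_sub, neg_div]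

/-- The law of a target node. -/
noncomputable abbrev nodeLaw (d : ℕ) (s : ℝ) : Measure (E d) :=
  multivariateGaussian (0 : E d) (s • (1 : Matrix (Fin d) (Fin d) ℝ))

lemma nodeLaw_closedBall_le {s l : ℝ} (hs : 0 < s) (hl : 0 < l) (z : E d) (t : ℝ) :
    nodeLaw d s (Metric.closedBall z t) ≤
      ENNReal.ofReal (Real.exp (l * (t ^ 2 / s)) * (2 * l) ^ (-(d / 2 : ℝ))) := by
  have hs' : 0 < √s := Real.sqrt_pos.2 hs
  rw [nodeLaw, multivariateGaussian_smul_one hs.le,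
    Measure.map_apply (by fun_prop) Metric.isClosed_closedBall.measurableSet]
  refine le_trans (measure_mono ?_) ((stdGaussian_closedBall_le hl ((√s)⁻¹ • z) (t / √s)).trans
    (le_of_eq ?_))
  · intro x hx
    rw [mem_preimage, mem_closedBall_iff_norm] at hx
    rw [mem_closedBall_iff_norm, le_div_iff₀ hs', mul_comm, ← Real.norm_of_nonneg hs'.le,
      ← norm_smul, smul_sub, smul_smul, Real.norm_of_nonneg hs'.le, mul_inv_cancel₀ hs'.ne',
      one_smul]
    exact hx
  · rw [div_pow, Real.sq_sqrt hs.le]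

lemma nodeLaw_norm_gt_le {s : ℝ} (hs : 0 < s) {t : ℝ} (ht : 0 ≤ t) :
    nodeLaw d s {x | t < ‖x‖} ≤
      ENNReal.ofReal (Real.exp (-(t ^ 2 / (4 * s))) * (1 / 2) ^ (-(d / 2 : ℝ))) := by
  have hs' : 0 < √s := Real.sqrt_pos.2 hs
  rw [nodeLaw, multivariateGaussian_smul_one hs.le,
    Measure.map_apply (by fun_prop) (measurableSet_lt measurable_const measurable_norm)]
  refine le_trans (measure_mono ?_)
    ((stdGaussian_norm_gt_le (t := t / √s) (by positivity)).trans (le_of_eq ?_))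
  · intro x hx
    rw [mem_preimage, mem_ofPred_eq, norm_smul, Real.norm_of_nonneg hs'.le] at hx
    rw [mem_ofPred_eq, div_lt_iff₀ hs', mul_comm]
    exact hx
  · rw [div_pow, Real.sq_sqrt hs.le, div_div, mul_comm s]

/-! ### The random target network is good -/

/-- Conditionally on w i this is a small-ball event for w j, and the small-ball bound is uniform in
the centre. -/
lemma pi_norm_sub_le {s l : ℝ} (hs : 0 < s) (hl : 0 < l) (t : ℝ) {i j : Fin k} (hij : i ≠ j) :
    (Measure.pi fun _ : Fin k => nodeLaw d s) {w | ‖w i - w j‖ ≤ t} ≤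
      ENNReal.ofReal (Real.exp (l * (t ^ 2 / s)) * (2 * l) ^ (-(d / 2 : ℝ))) := by
  have hind : IndepFun (fun w : Fin k → E d => w i) (fun w => w j)
      (Measure.pi fun _ : Fin k => nodeLaw d s) :=
    (iIndepFun_pi (μ := fun _ : Fin k => nodeLaw d s) (X := fun _ x => x)
      fun _ => aemeasurable_id).indepFun hij
  have hmap := (indepFun_iff_map_prod_eq_prod_map_map 
    (measurable_pi_apply i).aemeasurable (measurable_pi_apply j).aemeasurable).1 hind
  have h1 : ∀ i : Fin k, (Measure.pi fun _ : Fin k => nodeLaw d s).map (fun w => w i) =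
      nodeLaw d s := fun i => (measurePreserving_eval (fun _ : Fin k => nodeLaw d s) i).map_eq
  rw [h1, h1] at hmap
  have hmeas : MeasurableSet {x : E d × E d | ‖x.1 - x.2‖ ≤ t} :=
    measurableSet_le (by fun_prop) measurable_const
  have h2 : {w : Fin k → E d | ‖w i - w j‖ ≤ t} =
      (fun w : Fin k → E d => (w i, w j)) ⁻¹' {x | ‖x.1 - x.2‖ ≤ t} := rfl
  rw [h2, ← Measure.map_apply (by fun_prop) hmeas, hmap, Measure.prod_apply hmeas]
  refine (lintegral_mono (g := fun _ => ENNReal.ofReal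
    (Real.exp (l * (t ^ 2 / s)) * (2 * l) ^ (-(d / 2 : ℝ)))) fun x => ?_).trans ?_
  · refine le_trans (measure_mono fun y hy => ?_) (nodeLaw_closedBall_le hs hl x t)
    rw [mem_closedBall_iff_norm, norm_sub_rev]
    exact hy
  · rw [lintegral_const, measure_univ, mul_one]

lemma pi_norm_gt_le {s : ℝ} (hs : 0 < s) {t : ℝ} (ht : 0 ≤ t) (i : Fin k) :
    (Measure.pi fun _ : Fin k => nodeLaw d s) {w | t < ‖w i‖} ≤
      ENNReal.ofReal (Real.exp (-(t ^ 2 / (4 * s))) * (1 / 2) ^ (-(d / 2 : ℝ))) := by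
  have h := (measurePreserving_eval (fun _ : Fin k => nodeLaw d s) i).measure_preimage
    (measurableSet_lt measurable_const measurable_norm : MeasurableSet {x : E d | t < ‖x‖}
      ).nullMeasurableSet
  exact h.le.trans (nodeLaw_norm_gt_le hs ht)

/-- The law of a target output weight. -/
noncomputable abbrev weightLaw : Measure ℝ :=
  ProbabilityTheory.cond (volume : Measure ℝ) (Icc (-1) 1)

instance : IsProbabilityMeasure weightLaw :=
  cond_isProbabilityMeasure_of_finite (by simp) (by simp)

lemma weightLaw_le (β : ℝ) :
    weightLaw {x | ¬ (β ≤ |x| ∧ |x| ≤ 1)} ≤ ENNReal.ofReal β := by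
  rw [weightLaw, cond_apply measurableSet_Icc]
  have hsub : Icc (-1 : ℝ) 1 ∩ {x | ¬ (β ≤ |x| ∧ |x| ≤ 1)} ⊆ Icc (-β) β := by
    rintro x ⟨hx, hx'⟩
    have hx : |x| ≤ 1 := abs_le.2 hx
    have : |x| < β := by
      by_contra h
      exact hx' ⟨not_lt.1 h, hx⟩
    exact abs_le.1 this.le
  refine (mul_le_mul' le_rfl (measure_mono hsub)).trans (le_of_eq ?_)
  rw [Real.volume_Icc, Real.volume_Icc, ← ENNReal.ofReal_inv_of_pos (by norm_num),
    ← ENNReal.ofReal_mul (by norm_num)]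
  congr 1
  ring

lemma pi_weight_le (β : ℝ) (j : Fin k) :
    (Measure.pi fun _ : Fin k => weightLaw) {b | ¬ (β ≤ |b j| ∧ |b j| ≤ 1)} ≤
      ENNReal.ofReal β := by
  have hm : MeasurableSet {x : ℝ | ¬ (β ≤ |x| ∧ |x| ≤ 1)} :=
    ((measurableSet_le measurable_const measurable_id.abs).inter
      (measurableSet_le measurable_id.abs measurable_const)).compl
  have h := (measurePreserving_eval (fun _ : Fin k => weightLaw) j).measure_preimage
    hm.nullMeasurableSet
  exact h.le.trans (weightLaw_le β)

lemma targetLaw_fst_preimage {s : ℝ} (S : Set (Fin k → E d)) :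
    targetLaw d k s (Prod.fst ⁻¹' S) = (Measure.pi fun _ : Fin k => nodeLaw d s) S := by
  have : (Prod.fst ⁻¹' S : Set ((Fin k → E d) × (Fin k → ℝ))) = S ×ˢ univ := by ext; simp
  rw [targetLaw, this, Measure.prod_prod, measure_univ, mul_one]

lemma targetLaw_snd_preimage {s : ℝ} (S : Set (Fin k → ℝ)) :
    targetLaw d k s (Prod.snd ⁻¹' S) = (Measure.pi fun _ : Fin k => weightLaw) S := by
  have : (Prod.snd ⁻¹' S : Set ((Fin k → E d) × (Fin k → ℝ))) = univ ×ˢ S := by ext; simp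
  rw [targetLaw, this, Measure.prod_prod, measure_univ, one_mul]

/-- A union bound over close pairs, long nodes and bad weights. The norm bound keeps the targets
inside the sampling ball. -/
lemma targetLaw_not_good_le {s l β t r : ℝ} (hs : 0 < s) (hl : 0 < l) (hβ : 0 ≤ β) (ht : 0 ≤ t) :
    targetLaw d k s {x | ¬ (IsGoodTarget x.1 x.2 r β ∧ ∀ j, ‖x.1 j‖ ≤ t)} ≤
      ENNReal.ofReal
        (k ^ 2 * (Real.exp (l * ((3 * r) ^ 2 / s)) * (2 * l) ^ (-(d / 2 : ℝ))) +
          k * (Real.exp (-(t ^ 2 / (4 * s))) * (1 / 2) ^ (-(d / 2 : ℝ))) + k * β) := by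
  set P : ℝ := Real.exp (l * ((3 * r) ^ 2 / s)) * (2 * l) ^ (-(d / 2 : ℝ)) with hP
  set Q : ℝ := Real.exp (-(t ^ 2 / (4 * s))) * (1 / 2) ^ (-(d / 2 : ℝ)) with hQ
  have hP0 : 0 ≤ P := by positivity
  have hQ0 : 0 ≤ Q := by positivity
  have hk : ∀ x : ℝ, (k : ENNReal) * ENNReal.ofReal x = ENNReal.ofReal (k * x) := fun x => by
    rw [ENNReal.ofReal_mul (Nat.cast_nonneg k), ENNReal.ofReal_natCast]
  have hsub : {x : (Fin k → E d) × (Fin k → ℝ) |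
      ¬ (IsGoodTarget x.1 x.2 r β ∧ ∀ j, ‖x.1 j‖ ≤ t)} ⊆
      (⋃ i : Fin k, ⋃ j : Fin k, Prod.fst ⁻¹' {w | i ≠ j ∧ ‖w i - w j‖ ≤ 3 * r}) ∪
      (⋃ j : Fin k, Prod.fst ⁻¹' {w | t < ‖w j‖}) ∪
      (⋃ j : Fin k, Prod.snd ⁻¹' {b | ¬ (β ≤ |b j| ∧ |b j| ≤ 1)}) := by
    intro x hx
    by_contra hcon
    simp only [mem_union, mem_iUnion, mem_preimage, mem_ofPred_eq] at hcon
    push Not at hcon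
    refine hx ⟨⟨fun i j hij => (hcon.1.1 i j hij).le, fun j => (hcon.2 j).2,
      fun j => (hcon.2 j).1⟩, hcon.1.2⟩
  have h1 : targetLaw d k s
      (⋃ i : Fin k, ⋃ j : Fin k, Prod.fst ⁻¹' {w | i ≠ j ∧ ‖w i - w j‖ ≤ 3 * r}) ≤
      ENNReal.ofReal (k ^ 2 * P) := by
    refine (measure_iUnion_fintype_le _ _).trans ((Finset.sum_le_sum fun i _ =>
      measure_iUnion_fintype_le _ _).trans ((Finset.sum_le_sum fun i _ => Finset.sum_le_sum
        (g := fun _ => ENNReal.ofReal P) fun j _ => ?_).trans (le_of_eq ?_)))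
    · rw [targetLaw_fst_preimage]
      rcases eq_or_ne i j with h | h
      · simp [h]
      · exact (measure_mono fun w hw => hw.2).trans (pi_norm_sub_le hs hl (3 * r) h)
    · simp only [Finset.sum_const, Finset.card_univ, Fintype.card_fin, nsmul_eq_mul]
      rw [hk, hk, ← mul_assoc, sq]
  have h2 : targetLaw d k s (⋃ j : Fin k, Prod.fst ⁻¹' {w | t < ‖w j‖}) ≤
      ENNReal.ofReal (k * Q) := by
    refine (measure_iUnion_fintype_le _ _).trans ((Finset.sum_le_sum
      (g := fun _ => ENNReal.ofReal Q) fun j _ => ?_).trans (le_of_eq ?_))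
    · rw [targetLaw_fst_preimage]
      exact pi_norm_gt_le hs ht j
    · simp only [Finset.sum_const, Finset.card_univ, Fintype.card_fin, nsmul_eq_mul]
      rw [hk]
  have h3 : targetLaw d k s (⋃ j : Fin k, Prod.snd ⁻¹' {b | ¬ (β ≤ |b j| ∧ |b j| ≤ 1)}) ≤
      ENNReal.ofReal (k * β) := by
    refine (measure_iUnion_fintype_le _ _).trans ((Finset.sum_le_sum
      (g := fun _ => ENNReal.ofReal β) fun j _ => ?_).trans (le_of_eq ?_))
    · rw [targetLaw_snd_preimage]
      exact pi_weight_le β j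
    · simp only [Finset.sum_const, Finset.card_univ, Fintype.card_fin, nsmul_eq_mul]
      rw [hk]
  rw [ENNReal.ofReal_add (by positivity) (by positivity),
    ENNReal.ofReal_add (by positivity) (by positivity)]
  exact (measure_mono hsub).trans ((measure_union_le _ _).trans
    (add_le_add ((measure_union_le _ _).trans (add_le_add h1 h2)) h3))

lemma le_uniformBall {z : E d} {R t : ℝ} (ht : 0 ≤ t) (hR : 0 < R) (hz : ‖z‖ + t ≤ R) :
    ENNReal.ofReal ((t / R) ^ d) ≤ uniformBall d R (Metric.closedBall z t) := by
  have hsub : Metric.closedBall z t ⊆ Metric.closedBall 0 R :=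
    Metric.closedBall_subset_closedBall' (by rw [dist_zero_right]; linarith)
  have hV0 : volume (Metric.closedBall (0 : E d) 1) ≠ 0 :=
    (Metric.measure_closedBall_pos _ _ one_pos).ne'
  have hV1 : volume (Metric.closedBall (0 : E d) 1) ≠ ⊤ := measure_closedBall_lt_top.ne
  rw [uniformBall, cond_apply Metric.isClosed_closedBall.measurableSet, inter_eq_right.2 hsub,
    Measure.addHaar_closedBall' _ _ ht, Measure.addHaar_closedBall' _ _ hR.le,
    finrank_euclideanSpace_fin, ENNReal.mul_inv (Or.inr hV1) (Or.inr hV0), div_pow,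
    ENNReal.ofReal_div_of_pos (by positivity), ENNReal.div_eq_inv_mul]
  rw [mul_mul_mul_comm, ENNReal.inv_mul_cancel hV0 hV1, mul_one]

end

/-! ### Choice of the parameters -/

/-- All bounds are powers of Y, so the parameters can be fixed in turn as powers of Y, with γ = 1; Y
≥ 100 absorbs the numerical factors. -/
lemma exists_isGoodParams (K m : ℕ) : ∃ N : ℕ, ∀ (Y r M c κ β : ℝ) (k : ℕ), 100 ≤ Y → 2 ≤ r →
    1 ≤ k → (k : ℝ) ≤ Y ^ K → 1 ≤ M → M ≤ Y ^ 2 → (Y ^ 2)⁻¹ ≤ c → (Y ^ 2)⁻¹ ≤ κ →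
    (Y ^ m)⁻¹ ≤ β →
    ∃ (δ e α η γ : ℝ) (T : ℕ), IsGoodParams k r M c κ β δ e α η γ T ∧
      (Y ^ N)⁻¹ ≤ δ ∧ (k * T : ℝ) ≤ Y ^ N ∧ √(2 * k) * e ≤ Y⁻¹ := by
  -- The exponents of δ, e, η, α and T respectively. They come from `margin`, `residual`,
  -- `precision`, `step` and `steps`, in that order.
  set n₁ := K + 2 * m + 5 with hn₁
  set n₂ := n₁ + 3 with hn₂
  set n₃ := n₂ + 2 * n₁ + 5 with hn₃
  set n₄ := 2 * K + 5 with hn₄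
  set n₅ := 2 * K + 2 * n₄ + 2 * n₃ + 3 with hn₅
  refine ⟨K + n₅ + 1, fun Y r M c κ β k hY hr hk hkY hM hMY hc hκ hβ => ?_⟩
  have hY0 : 0 < Y := by linarith
  have hY1 : 1 ≤ Y := by linarith
  have hp : ∀ n : ℕ, 0 < Y ^ n := fun n => pow_pos hY0 n
  have hp1 : ∀ n : ℕ, 1 ≤ Y ^ n := fun n => one_le_pow₀ hY1
  have hmono : ∀ {a b : ℕ}, a ≤ b → Y ^ a ≤ Y ^ b := fun h => pow_le_pow_right₀ hY1 h
  have hanti : ∀ {a b : ℕ}, a ≤ b → (Y ^ b)⁻¹ ≤ (Y ^ a)⁻¹ := fun h =>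
    inv_anti₀ (hp _) (hmono h)
  have hcancel : ∀ a b : ℕ, Y ^ a * (Y ^ (b + a))⁻¹ = (Y ^ b)⁻¹ := fun a b => by
    rw [pow_add, mul_inv, mul_comm, mul_assoc, inv_mul_cancel₀ (hp a).ne', mul_one]
  have hk1 : (1 : ℝ) ≤ k := by exact_mod_cast hk
  have hc0 : 0 < c := (inv_pos.2 (hp 2)).trans_le hc
  have hκ0 : 0 < κ := (inv_pos.2 (hp 2)).trans_le hκ
  have hβ0 : 0 < β := (inv_pos.2 (hp m)).trans_le hβ
  have hM0 : 0 < M := by linarith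
  have he1 : (Y ^ n₂)⁻¹ ≤ 1 := inv_le_one_of_one_le₀ (hp1 _)
  have hmin : (Y ^ (2 * n₄ + 2 * n₃ + 1))⁻¹ ≤
      min ((Y ^ n₄)⁻¹ * (Y ^ n₃)⁻¹ ^ 2 / 2) ((Y ^ n₄)⁻¹ ^ 2 * 1 ^ 3 / 2) := by
    have h2 : Y⁻¹ ≤ 1 / 2 := by rw [one_div]; exact inv_anti₀ two_pos (by linarith)
    have h3 : (Y ^ (n₄ + 2 * n₃))⁻¹ = (Y ^ n₄)⁻¹ * (Y ^ n₃)⁻¹ ^ 2 := by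
      rw [pow_add, mul_inv, mul_comm 2, pow_mul, inv_pow]
    have h4 : (Y ^ (2 * n₄))⁻¹ = (Y ^ n₄)⁻¹ ^ 2 := by rw [mul_comm, pow_mul, inv_pow]
    have h5 : ∀ a : ℕ, a ≤ 2 * n₄ + 2 * n₃ →
        (Y ^ (2 * n₄ + 2 * n₃ + 1))⁻¹ ≤ (Y ^ a)⁻¹ / 2 := by
      intro a ha
      rw [pow_succ, mul_inv, div_eq_mul_one_div]
      exact mul_le_mul (hanti ha) h2 (by positivity) (inv_pos.2 (hp a)).le
    rw [le_min_iff, ← h3, one_pow, mul_one, ← h4]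
    exact ⟨h5 _ (by omega), h5 _ (by omega)⟩
  refine ⟨(Y ^ n₁)⁻¹, (Y ^ n₂)⁻¹, (Y ^ n₄)⁻¹, (Y ^ n₃)⁻¹, 1, ⌈Y ^ n₅⌉₊,
    ⟨inv_pos.2 (hp _), by linarith, he1, inv_pos.2 (hp _), inv_pos.2 (hp _), inv_pos.2 (hp _),
      one_pos, hc0, hκ0, hβ0, hM, ?_, hanti (by omega), ?_, ?_, ?_, ?_⟩, hanti (by omega), ?_, ?_⟩
  · calc (M + 1) * (Y ^ n₂)⁻¹ < Y ^ 3 * (Y ^ n₂)⁻¹ := by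
          refine mul_lt_mul_of_pos_right ?_ (inv_pos.2 (hp _))
          nlinarith [hp1 2]
      _ = _ := hcancel 3 n₁
  · have h1 : M / (c * (Y ^ n₁)⁻¹ ^ 2) ≤ Y ^ (2 * n₁ + 4) := by
      rw [div_le_iff₀ (by positivity)]
      calc M ≤ Y ^ 2 := hMY
        _ = Y ^ (2 * n₁ + 4) * ((Y ^ 2)⁻¹ * (Y ^ n₁)⁻¹ ^ 2) := by
          have : Y ^ (2 * n₁ + 4) = Y ^ 2 * Y ^ 2 * (Y ^ n₁) ^ 2 := by ring
          rw [this]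
          field_simp
        _ ≤ _ := by gcongr
    have h2 : 1 + Y ^ (2 * n₁ + 4) ≤ Y ^ (2 * n₁ + 5) := by
      rw [pow_succ Y (2 * n₁ + 4)]; nlinarith [hp1 (2 * n₁ + 4)]
    calc (Y ^ n₃)⁻¹ + M * ((Y ^ n₃)⁻¹ / (c * (Y ^ n₁)⁻¹ ^ 2))
        = (1 + M / (c * (Y ^ n₁)⁻¹ ^ 2)) * (Y ^ n₃)⁻¹ := by ring
      _ ≤ Y ^ (2 * n₁ + 5) * (Y ^ n₃)⁻¹ := by
        gcongr
        linarith
      _ = _ := hcancel (2 * n₁ + 5) n₂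
  · have h1 : 1 + (4 * (3 * (k : ℝ)) + 1) * (3 * k * M) ≤ Y ^ (2 * K + 3) + Y ^ (2 * K + 3) := by
      have h2 : (4 * (3 * (k : ℝ)) + 1) * (3 * k * M) ≤ (13 * Y ^ K) * (3 * Y ^ K * Y ^ 2) := by
        gcongr
        linarith
      have h3 : (13 * Y ^ K) * (3 * Y ^ K * Y ^ 2) ≤ Y ^ (2 * K + 3) := by
        have : Y ^ (2 * K + 3) = Y * (Y ^ K * Y ^ K * Y ^ 2) := by ring
        rw [this]
        have : 0 < Y ^ K * Y ^ K * Y ^ 2 := by positivity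
        nlinarith
      linarith [hp1 (2 * K + 3)]
    calc (Y ^ n₄)⁻¹ * (1 + (4 * (3 * (k : ℝ)) + 1) * (3 * k * M))
        ≤ (Y ^ n₄)⁻¹ * (Y ^ (2 * K + 3) + Y ^ (2 * K + 3)) := by gcongr
      _ = 2 * (Y ^ (2 * K + 3) * (Y ^ n₄)⁻¹) := by ring
      _ = 2 * (Y ^ 2)⁻¹ := by
        rw [← hcancel (2 * K + 3) 2, hn₄]
        congr 4
        omega
      _ < 1 / 2 := by
        rw [← div_eq_mul_inv, div_lt_div_iff₀ (hp 2) two_pos]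
        nlinarith
  · have h1 : 16 * (k : ℝ) ^ 2 < Y ^ (2 * K + 1) := by
      calc 16 * (k : ℝ) ^ 2 ≤ 16 * (Y ^ K) ^ 2 := by gcongr
        _ < Y * (Y ^ K) ^ 2 := by
          have := pow_pos (hp K) 2
          exact mul_lt_mul_of_pos_right (by linarith) this
        _ = _ := by ring
    calc 16 * (k : ℝ) ^ 2 < Y ^ (2 * K + 1) := h1
      _ ≤ Y ^ (2 * K + 2) := hmono (by omega)
      _ = Y ^ n₅ * (Y ^ (2 * n₄ + 2 * n₃ + 1))⁻¹ := by
        have : n₅ = (2 * K + 2) + (2 * n₄ + 2 * n₃ + 1) := by omega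
        rw [this, pow_add Y (2 * K + 2) (2 * n₄ + 2 * n₃ + 1), mul_assoc,
          mul_inv_cancel₀ (hp _).ne', mul_one]
      _ ≤ _ := by
        gcongr
        exact Nat.le_ceil _
  · calc 8 * (k : ℝ) * (Y ^ n₁)⁻¹ ≤ Y * Y ^ K * (Y ^ n₁)⁻¹ := by gcongr; linarith
      _ = ((Y ^ m)⁻¹ * (Y ^ 2)⁻¹) ^ 2 := by
        have : Y ^ n₁ = Y * Y ^ K * (Y ^ m * Y ^ 2) ^ 2 := by rw [hn₁]; ring
        rw [this]
        field_simp
      _ ≤ (β * κ) ^ 2 := by gcongr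
  · have h1 : (⌈Y ^ n₅⌉₊ : ℝ) ≤ Y ^ (n₅ + 1) := by
      have := (Nat.ceil_lt_add_one (hp n₅).le).le
      rw [pow_succ Y n₅]
      nlinarith [hp1 n₅]
    calc (k : ℝ) * ⌈Y ^ n₅⌉₊ ≤ Y ^ K * Y ^ (n₅ + 1) := by gcongr
      _ = _ := by rw [← pow_add]; rfl
  · have h1 : √(2 * k) ≤ Y ^ (K + 1) := by
      calc √(2 * (k : ℝ)) ≤ 2 * k := by
            rw [Real.sqrt_le_left (by linarith)]; nlinarith
        _ ≤ Y * Y ^ K := by gcongr; linarith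
        _ = _ := by ring
    calc √(2 * (k : ℝ)) * (Y ^ n₂)⁻¹ ≤ Y ^ (K + 1) * (Y ^ (1 + (K + 1)))⁻¹ := by
          gcongr
          omega
      _ = _ := by rw [hcancel, pow_one]

/-! ### The failure probability -/

/-- With l = s/d, two nodes are close with probability at most e^(9d)(2s/d)^(-d/2). Since 2s/d ≥
e^20 this is at most e^(-d), which beats k². The tail at C d log d / 2 has exponent at least (K + q
+ 3) d log d, and the weight cutoff is d^(-(q+K+1)). Each of the three terms is at most d^(-(q+1)),
and 3 ≤ d. -/
lemma failure_probability_le {K q k d : ℕ} {c₁ c₂ s C : ℝ} (hd : 3 ≤ d)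
    (hk : (k : ℝ) ≤ (d : ℝ) ^ K) (hs : 0 < s) (hs₁ : c₁ * (d * Real.log d) ≤ s)
    (hs₂ : s ≤ c₂ * (d * Real.log d)) (hlog : 1 ≤ Real.log d)
    (hlog₁ : Real.exp 20 ≤ 2 * (c₁ * Real.log d))
    (hlog₂ : (2 * K + q + 1) * Real.log d ≤ d) (hC : 16 * c₂ * (K + q + 3) ≤ C ^ 2) :
    (k : ℝ) ^ 2 * (Real.exp (s / d * ((3 * d) ^ 2 / s)) * (2 * (s / d)) ^ (-(d / 2 : ℝ))) +
      k * (Real.exp (-((C * (d * Real.log d) / 2) ^ 2 / (4 * s))) * (1 / 2) ^ (-(d / 2 : ℝ))) +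
      k * ((d : ℝ) ^ (q + K + 1))⁻¹ ≤ ((d : ℝ) ^ q)⁻¹ := by
  have hd3 : (3 : ℝ) ≤ d := by exact_mod_cast hd
  have hd0 : (0 : ℝ) < d := by linarith
  set ℓ := Real.log d with hℓ
  have hpow : ∀ n : ℕ, (d : ℝ) ^ n = Real.exp (n * ℓ) := fun n => by
    rw [Real.exp_nat_mul, Real.exp_log hd0]
  have hinv : ∀ n : ℕ, ((d : ℝ) ^ n)⁻¹ = Real.exp (-(n * ℓ)) := fun n => by
    rw [hpow, Real.exp_neg]
  have h1 : (k : ℝ) ^ 2 *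
      (Real.exp (s / d * ((3 * d) ^ 2 / s)) * (2 * (s / d)) ^ (-(d / 2 : ℝ))) ≤
      ((d : ℝ) ^ (q + 1))⁻¹ := by
    have e1 : s / d * ((3 * d) ^ 2 / s) = 9 * d := by field_simp; ring
    have e2 : (2 * (s / d)) ^ (-(d / 2 : ℝ)) ≤ Real.exp (-(10 * d)) := by
      have : Real.exp 20 ≤ 2 * (s / d) := by
        refine hlog₁.trans ?_
        gcongr
        rw [le_div_iff₀ hd0]
        linarith
      calc (2 * (s / d)) ^ (-(d / 2 : ℝ)) ≤ Real.exp 20 ^ (-(d / 2 : ℝ)) :=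
            Real.rpow_le_rpow_of_nonpos (Real.exp_pos _) this (by linarith)
        _ = _ := by rw [← Real.exp_mul]; congr 1; ring
    calc _ ≤ ((d : ℝ) ^ K) ^ 2 * (Real.exp (9 * d) * Real.exp (-(10 * d))) := by
          rw [e1]; gcongr
      _ = Real.exp (2 * K * ℓ - d) := by
          rw [← pow_mul, hpow, ← Real.exp_add, ← Real.exp_add]; push_cast; congr 1; ring
      _ ≤ _ := by
          rw [hinv, Real.exp_le_exp]; push_cast; linarith
  have h2 : (k : ℝ) *
      (Real.exp (-((C * (d * ℓ) / 2) ^ 2 / (4 * s))) * (1 / 2) ^ (-(d / 2 : ℝ))) ≤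
      ((d : ℝ) ^ (q + 1))⁻¹ := by
    have e1 : (1 / 2 : ℝ) ^ (-(d / 2 : ℝ)) ≤ Real.exp d := by
      have h2e : (1 / 2 : ℝ) = 2⁻¹ := by norm_num
      rw [h2e, Real.inv_rpow two_pos.le, Real.rpow_neg two_pos.le, inv_inv,
        Real.rpow_def_of_pos two_pos, Real.exp_le_exp]
      nlinarith [Real.log_two_lt_d9]
    have e2 : (K + q + 3) * (d * ℓ) ≤ (C * (d * ℓ) / 2) ^ 2 / (4 * s) := by
      rw [le_div_iff₀ (by linarith)]
      have hdl : 0 < d * ℓ := by positivity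
      calc (K + q + 3) * (d * ℓ) * (4 * s)
          ≤ (K + q + 3) * (d * ℓ) * (4 * (c₂ * (d * ℓ))) := by gcongr
        _ = (16 * c₂ * (K + q + 3)) * ((d * ℓ) ^ 2 / 4) := by ring
        _ ≤ C ^ 2 * ((d * ℓ) ^ 2 / 4) := by gcongr
        _ = _ := by ring
    have e3 : ℓ ≤ d * ℓ := by nlinarith
    have e4 : (d : ℝ) ≤ d * ℓ := by nlinarith
    calc _ ≤ (d : ℝ) ^ K * (Real.exp (-((K + q + 3) * (d * ℓ))) * Real.exp d) := by
          gcongr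
      _ = Real.exp (K * ℓ + (-((K + q + 3) * (d * ℓ)) + d)) := by
          rw [hpow, ← Real.exp_add, ← Real.exp_add]
      _ ≤ _ := by
          rw [hinv, Real.exp_le_exp]
          push_cast
          have : (K + q + 1) * ℓ ≤ (K + q + 1) * (d * ℓ) := by gcongr
          nlinarith
  have h3 : (k : ℝ) * ((d : ℝ) ^ (q + K + 1))⁻¹ ≤ ((d : ℝ) ^ (q + 1))⁻¹ := by
    calc _ ≤ (d : ℝ) ^ K * ((d : ℝ) ^ (q + K + 1))⁻¹ := by gcongr
      _ = _ := by
        rw [show q + K + 1 = K + (q + 1) by ring, pow_add, mul_inv, ← mul_assoc,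
          mul_inv_cancel₀ (by positivity), one_mul]
  calc _ ≤ ((d : ℝ) ^ (q + 1))⁻¹ + ((d : ℝ) ^ (q + 1))⁻¹ + ((d : ℝ) ^ (q + 1))⁻¹ :=
        add_le_add (add_le_add h1 h2) h3
    _ = 3 * (d : ℝ)⁻¹ * ((d : ℝ) ^ q)⁻¹ := by rw [pow_succ, mul_inv]; ring
    _ ≤ 1 * ((d : ℝ) ^ q)⁻¹ := by
        gcongr
        rw [← div_eq_mul_inv, div_le_one hd0]
        exact hd3
    _ = _ := one_mul _

lemma eventually_large (A B q : ℝ) : ∃ d₀ : ℕ, ∀ d : ℕ, d₀ ≤ d →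
    A ≤ d ∧ B ≤ Real.log d ∧ q * Real.log d ≤ d := by
  have h1 : ∀ᶠ d : ℕ in Filter.atTop, A ≤ d :=
    tendsto_natCast_atTop_atTop.eventually_ge_atTop A
  have h2 : ∀ᶠ d : ℕ in Filter.atTop, B ≤ Real.log d :=
    (Real.tendsto_log_atTop.comp tendsto_natCast_atTop_atTop).eventually_ge_atTop B
  have h3 : ∀ᶠ d : ℕ in Filter.atTop, q * Real.log d ≤ d := by
    have h := (Real.isLittleO_log_id_atTop.const_mul_left q).def one_pos
    filter_upwards [tendsto_natCast_atTop_atTop.eventually h] with d hd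
    simp only [id, one_mul, Real.norm_natCast] at hd
    exact (le_abs_self _).trans hd
  exact Filter.eventually_atTop.1 (h1.and (h2.and h3))

/-- The ratio of radii is (2C log d)⁻¹, which is at least (log d)⁻² once log d ≥ 2C. -/
lemma inv_log_rpow_le {d : ℕ} {C : ℝ} (hC : 2 ≤ C) (hlog : 2 * C ≤ Real.log d) (hd : 0 < d) :
    Real.log d ^ (-(C * d)) ≤ ((d / 2 : ℝ) / (C * (d * Real.log d))) ^ d := by
  have hd0 : (0 : ℝ) < d := by exact_mod_cast hd
  set ℓ := Real.log d with hℓ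
  have hℓ0 : 0 < ℓ := by linarith
  have h1 : (d / 2 : ℝ) / (C * (d * ℓ)) = (2 * C * ℓ)⁻¹ := by field_simp
  have h2 : (ℓ ^ 2)⁻¹ ≤ (2 * C * ℓ)⁻¹ := by
    refine inv_anti₀ (by positivity) ?_
    rw [sq]; gcongr
  calc ℓ ^ (-(C * d)) ≤ ℓ ^ (-(2 * d : ℝ)) :=
        Real.rpow_le_rpow_of_exponent_le (by linarith) (by gcongr)
    _ = ((ℓ ^ 2)⁻¹) ^ d := by
        rw [Real.rpow_neg hℓ0.le, inv_pow, ← pow_mul]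
        congr 1
        exact_mod_cast Real.rpow_natCast ℓ (2 * d)
    _ ≤ _ := by rw [h1]; gcongr

end NodeWise

/-! ### Assembly of the estimates and the final constants -/

theorem mainTheorem1 :
    ∃ σ : (d : ℕ) → ℝ → NodeWise.E d → NodeWise.E d → ℝ,
      (∀ d : ℕ, d % 4 = 3 → ∀ ε : ℝ, 0 < ε → ε < 1 → NodeWise.IsActivation (σ d ε)) ∧
      ∀ (K q : ℕ) (c₁ c₂ : ℝ), 0 < c₁ → c₁ ≤ c₂ →
        ∃ c C : ℝ, 0 < c ∧ 0 < C ∧ ∃ d₀ : ℕ,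
          ∀ d : ℕ, d₀ ≤ d → d % 4 = 3 → ∀ ε : ℝ, 0 < ε → ε < 1 →
          ∀ k : ℕ, 1 ≤ k → k ≤ d ^ K →
          ∀ s : ℝ, c₁ * (d * Real.log d) ≤ s → s ≤ c₂ * (d * Real.log d) →
            ∃ (δ α η γ : ℝ) (T : ℕ),
              0 < α ∧ 0 < η ∧ 0 < γ ∧
              (d / ε : ℝ) ^ (-(C * d)) ≤ δ ∧
              (k * T : ℝ) ≤ (d / ε : ℝ) ^ (C * d) ∧
              NodeWise.targetLaw d k s
                {t | ¬ ∀ v : (NodeWise.Node d →L[ℝ] NodeWise.Node d) → NodeWise.Node d,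
                  NodeWise.IsMinEigenvectorChoice v →
                    NodeWise.InitSucceeds (NodeWise.loss (σ d ε) t.1 t.2) v T α η γ δ
                      (C * (d * Real.log d)) (Real.log d ^ (-(C * d))) ∧
                    NodeWise.Recovers (σ d ε) t.1 t.2 v T α η γ δ
                      ((d / ε : ℝ) ^ (-(c * d)))}
                ≤ ENNReal.ofReal (((d : ℝ) ^ q)⁻¹) := by
  refine ⟨fun d _ => NodeWise.activation d, fun d hd _ _ _ =>
    NodeWise.isActivation_activation (by omega), fun K q c₁ c₂ hc₁ hc₁₂ => ?_⟩
  have hc₂ : 0 < c₂ := hc₁.trans_le hc₁₂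
  obtain ⟨A, hA1, hA⟩ := NodeWise.exists_isLocalKernel
  obtain ⟨N, hN⟩ := NodeWise.exists_isGoodParams K (q + K + 1)
  -- The term N covers the bounds on δ and kT, 2 the sampling probability, and the last term the
  -- Gaussian tail.
  set C : ℝ := N + 2 + 16 * c₂ * (K + q + 3) with hC
  have hCpos : 0 ≤ 16 * c₂ * (K + q + 3) := by positivity
  have hN0 : (0 : ℝ) ≤ N := Nat.cast_nonneg N
  have hCN : (N : ℝ) ≤ C := by linarith
  have hC2 : 2 ≤ C := by linarith
  obtain ⟨d₀, hd₀⟩ := NodeWise.eventually_large (A + 100)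
    (2 * C + Real.exp 20 / (2 * c₁)) (2 * K + q + 1)
  -- The exponent c = 1 matches the final error Y⁻¹ = (d/ε)^(-d).
  refine ⟨1, C, one_pos, by linarith, d₀, fun d hd _ ε hε hε1 k hk hkK s hs₁ hs₂ => ?_⟩
  obtain ⟨hdA, hlog, hlog₂⟩ := hd₀ d hd
  have hd100 : (100 : ℝ) ≤ d := by linarith
  have hd0 : (0 : ℝ) < d := by linarith
  have hd3 : 3 ≤ d := by
    have : (3 : ℝ) ≤ d := by linarith
    exact_mod_cast this
  have hexp : 0 < Real.exp 20 / (2 * c₁) := by positivity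
  have hlogC : 2 * C ≤ Real.log d := by linarith
  have hlog1 : 1 ≤ Real.log d := by linarith
  have hlog₁ : Real.exp 20 ≤ 2 * (c₁ * Real.log d) := by
    have : Real.exp 20 / (2 * c₁) ≤ Real.log d := by linarith
    rw [div_le_iff₀ (by positivity)] at this
    linarith
  have hs : 0 < s := lt_of_lt_of_le (by positivity) hs₁
  have hkr : (k : ℝ) ≤ (d : ℝ) ^ K := by exact_mod_cast hkK
  set D : ℝ := d / ε with hD
  have hdD : (d : ℝ) ≤ D := by rw [hD, le_div_iff₀ hε]; nlinarith
  have hD0 : 0 < D := hd0.trans_le hdD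
  have hD1 : 1 ≤ D := by linarith
  -- Fixed powers of Y are exactly the permitted bounds (d/ε)^(Cd), and Y dominates both d and 4^d.
  set Y : ℝ := D ^ d with hY
  have hdY : (d : ℝ) ≤ Y := hdD.trans (le_self_pow₀ hD1 (by omega))
  have h4Y : (4 : ℝ) ^ d ≤ Y := pow_le_pow_left₀ (by norm_num) (by linarith) d
  have hY1 : 1 ≤ Y := by linarith
  have hYpow : ∀ x : ℝ, D ^ (x * d) = Y ^ x := fun x => by
    rw [mul_comm, Real.rpow_mul hD0.le, Real.rpow_natCast]
  have hMY : A * 4 ^ d ≤ Y ^ 2 := by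
    rw [sq]
    exact mul_le_mul (by linarith) h4Y (by positivity) (by linarith)
  have hM1 : 1 ≤ A * 4 ^ d := one_le_mul_of_one_le_of_one_le hA1 (one_le_pow₀ (by norm_num))
  obtain ⟨G, hker⟩ := hA d (by omega)
  obtain ⟨δ, e, α, η, γ, T, hP, hδ, hT, he⟩ := hN Y d (A * 4 ^ d) (2 / d ^ 2) (A⁻¹ * 4⁻¹ ^ d)
    ((d : ℝ) ^ (q + K + 1))⁻¹ k (by linarith) (by linarith) hk
    (hkr.trans (by gcongr)) hM1 hMY
    (by
      rw [inv_eq_one_div]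
      exact div_le_div₀ (by norm_num) (by norm_num) (by positivity) (by gcongr))
    (by rw [inv_pow, ← mul_inv]; exact inv_anti₀ (by positivity) hMY)
    (inv_anti₀ (by positivity) (by gcongr))
  refine ⟨δ, α, η, γ, T, hP.α_pos, hP.η_pos, hP.γ_pos, ?_, ?_, ?_⟩
  · rw [Real.rpow_neg hD0.le, hYpow]
    refine le_trans (inv_anti₀ (by positivity) ?_) hδ
    rw [← Real.rpow_natCast]
    exact Real.rpow_le_rpow_of_exponent_le hY1 hCN
  · rw [hYpow]
    refine hT.trans ?_
    rw [← Real.rpow_natCast]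
    exact Real.rpow_le_rpow_of_exponent_le hY1 hCN
  · have hdl : 0 < d * Real.log d := by positivity
    -- Taking t to be half the sampling radius leaves room for the ball of radius d/2 around each
    -- target.
    refine le_trans (measure_mono ?_) ((NodeWise.targetLaw_not_good_le (r := d)
      (β := ((d : ℝ) ^ (q + K + 1))⁻¹) (t := C * (d * Real.log d) / 2) (l := s / d) hs
      (by positivity) (by positivity) (by positivity)).trans (ENNReal.ofReal_le_ofReal
        (NodeWise.failure_probability_le hd3 hkr hs hs₁ hs₂ hlog1 hlog₁ hlog₂ ?_)))
    · intro t ht hgood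
      obtain ⟨hg, hnorm⟩ := hgood
      refine ht fun v _ => ⟨?_, ?_⟩
      · refine NodeWise.initSucceeds_of_isGoodParams NodeWise.memLp_activation
          NodeWise.potential_activation hker hg hP v hd0.le fun j => ?_
        refine (ENNReal.ofReal_le_ofReal (NodeWise.inv_log_rpow_le hC2 hlogC (by omega))).trans
          (NodeWise.le_uniformBall (by positivity) (by positivity) ?_)
        have h1 : (d : ℝ) ≤ C * (d * Real.log d) := by nlinarith
        linarith [hnorm j]
      · intro start hstart
        obtain ⟨π, hπ, hdist⟩ := NodeWise.recovers_of_isGoodParams NodeWise.memLp_activation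
          NodeWise.potential_activation hker hg hP v start hstart
        refine ⟨π, hπ, hdist.trans (he.trans (le_of_eq ?_))⟩
        rw [Real.rpow_neg hD0.le, hYpow, Real.rpow_one]
    · nlinarith
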